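/- Let $\mathcal A$ be the quasi-local $C^*$-algebra of the quantum spin chain over $\mathbb Z$ with single-site algebra $M_d(\mathbb C)$ (the norm completion of the union of the local algebras $\bigotimes_{j=q}^{p}M_d(\mathbb C)$), let $x^{(j)}\in\mathcal A$ denote $x\in M_d(\mathbb C)$ placed at site $j$, and let $\tau$ be the translation automorphism, $\tau(x^{(j)})=x^{(j+1)}$. Let $\omega$ be a state on $\mathcal A$ that is translation-invariant, $\omega\circ\tau=\omega$, and clustering: $\lim_{n\to\pm\infty}\omega(a^\dagger\tau^n(b)c)=\omega(a^\dagger c)\,\omega(b)$ for all $a,b,c\in\mathcal A$. Let $v_1,\dots,v_{d^2}\in M_d(\mathbb C)$ be hermitian with $\mathrm{Tr}(v_\mu v_\nu)=\delta_{\mu\nu}$, let $\epsilon_\mu\in\mathbb R$, let $h=[h_{\mu\nu}]$ be a hermitian and $C=[C_{\mu\nu}]$ a positive semi-definite complex $d^2\times d^2$ matrix. For $N\ge1$ put $V^{(N)}_\mu=N^{-1/2}\sum_{k=0}^{N-1}v_\mu^{(k)}$, $$K^{(N)}=\sum_\mu\epsilon_\mu\sum_{k=0}^{N-1}v_\mu^{(k)}+\frac1N\sum_{\mu,\nu}h_{\mu\nu}\sum_{k,\ell=0}^{N-1}v_\mu^{(k)}v_\nu^{(\ell)},$$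 $$\mathbb L^{(N)}[x]=i[K^{(N)},x]+\sum_{\mu,\nu}\frac{C_{\mu\nu}}2\Big([V^{(N)}_\mu,x]V^{(N)}_\nu+V^{(N)}_\mu[x,V^{(N)}_\nu]\Big),\qquad \gamma^{(N)}_t=e^{t\mathbb L^{(N)}}.$$ Write $X^{(N)}=\frac1N\sum_{k=0}^{N-1}x^{(k)}$ for $x\in M_d(\mathbb C)$, $\widetilde B_{\mu\nu}=\frac12(C_{\mu\nu}-C_{\nu\mu})+2i\,\mathrm{Re}\,h_{\mu\nu}$, and $J^\gamma_{\alpha\beta}=\mathrm{Tr}([v_\alpha,v_\beta]v_\gamma)$. Then for every $t\ge0$ (not only for short times) the macroscopic averages $$\omega_\alpha(t)=\lim_{N\to\infty}\omega\Big(\gamma^{(N)}_t\Big[\frac1N\sum_{k=0}^{N-1}v_\alpha^{(k)}\Big]\Big),\qquad \omega_{\alpha\beta}(t)=\lim_{N\to\infty}\omega\Big(\gamma^{(N)}_t\Big[\frac1N\sum_{k=0}^{N-1}[v_\alpha,v_\beta]^{(k)}\Big]\Big)$$ exist; the $\omega_\alpha(t)$ are real, $\omega_{\alpha\beta}(t)=\sum_\gamma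 J^\gamma_{\alpha\beta}\,\omega_\gamma(t)$, and $\omega_\alpha(0)=\omega(v_\alpha^{(0)})$. For every $t\ge0$ (with the right derivative at $t=0$) they satisfy $$\frac{d}{dt}\omega_\alpha(t)=\sum_{\mu}\Big(\sum_{\nu}\widetilde B_{\mu\nu}\,\omega_\nu(t)+i\epsilon_\mu\Big)\omega_{\mu\alpha}(t)=\sum_{\mu,\gamma}\Big(\sum_{\nu}\widetilde B_{\mu\nu}\,\omega_\nu(t)+i\epsilon_\mu\Big)J^\mu_{\alpha\gamma}\,\omega_\gamma(t),$$ that is, $\frac{d}{dt}\vec\omega_t=D(\vec\omega_t)\,\vec\omega_t$ with $D_{\alpha\beta}(\vec r)=\sum_{\mu,\nu}J^\mu_{\alpha\beta}\widetilde B_{\mu\nu}r_\nu+i\sum_\mu\epsilon_\mu J^\mu_{\alpha\beta}$, and for every real vector $\vec r$ the matrix $D(\vec r)$ is real and antisymmetric. Moreover there are unitary matrices $U_t\in M_d(\mathbb C)$, $t\ge0$, with $U_0=\mathbf 1$ and $\frac{d}{dt}U_t=-iH_tU_t$, where $H_t=-i\sum_\mu\big(\sum_\nu\widetilde B_{\mu\nu}\omega_\nu(t)+i\epsilon_\mu\big)v_\mu$,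 such that, with $\alpha_t[x]:=U_t^\dagger xU_t$ acting site by site, $\omega\big((\alpha_t[v_\alpha])^{(0)}\big)=\omega_\alpha(t)$ for all $\alpha$, and for all $t\ge0$, $x\in M_d(\mathbb C)$ and $a,b\in\mathcal A$ $$\lim_{N\to\infty}\omega\big(a\,\gamma^{(N)}_t[X^{(N)}]\,b\big)=\lim_{N\to\infty}\omega\Big(a\,\frac1N\sum_{k=0}^{N-1}(\alpha_t[x])^{(k)}\,b\Big)=\omega(ab)\,\omega\big((\alpha_t[x])^{(0)}\big).$$ -/

import Mathlib

open Filter Topology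
open scoped ComplexOrder ENNReal

noncomputable section

namespace MeanFieldChain

/-! ## The quasi-local algebra of the spin chain

Spin configurations are functions `σ : ℤ → Fin d`.  On the Hilbert space `ℓ²(ℤ → Fin d)` a matrix
`x` at site `j` acts on the `j`-th spin and as the identity on all the other ones.  For a finite
region `S` this Hilbert space is a direct sum of copies of `(ℂ^d)^{⊗ S}`, so the operators
supported in `S` form a faithful copy of the full matrix algebra `⨂_{j ∈ S} M_d(ℂ)` with its
C*-norm, compatibly with the inclusions `S ⊆ S'`.  The norm closure of the union of these local
algebras is hence the C*-inductive limit of the local matrix algebras. -/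

/-- The Hilbert space `ℓ²(ℤ → Fin d)`. -/
abbrev Hilb (d : ℕ) : Type := lp (fun _ : ℤ → Fin d => ℂ) 2

/-- A permutation of the configurations acts unitarily: `(permOp e ψ) σ = ψ (e σ)`. -/
def permOp {d : ℕ} (e : Equiv.Perm (ℤ → Fin d)) : Hilb d ≃ₗᵢ[ℂ] Hilb d where
  toFun ψ := ⟨fun σ => ψ (e σ), memℓp_gen <|
    e.summable_iff.mpr ((lp.memℓp ψ).summable (by norm_num))⟩
  invFun ψ := ⟨fun σ => ψ (e.symm σ), memℓp_gen <|
    e.symm.summable_iff.mpr ((lp.memℓp ψ).summable (by norm_num))⟩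
  left_inv ψ := by ext σ; simp
  right_inv ψ := by ext σ; simp
  map_add' _ _ := rfl
  map_smul' _ _ := rfl
  norm_map' ψ := by
    have h2 : 0 < (2 : ℝ≥0∞).toReal := by norm_num
    rw [lp.norm_eq_tsum_rpow h2, lp.norm_eq_tsum_rpow h2]
    congr 1
    exact e.tsum_eq (fun σ => ‖ψ σ‖ ^ (2 : ℝ≥0∞).toReal)

@[simp] theorem permOp_apply {d : ℕ} (e : Equiv.Perm (ℤ → Fin d)) (ψ : Hilb d) (σ : ℤ → Fin d) :
    (permOp e ψ) σ = ψ (e σ) := rfl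

@[simp] theorem permOp_symm_apply {d : ℕ} (e : Equiv.Perm (ℤ → Fin d)) (ψ : Hilb d)
    (σ : ℤ → Fin d) : ((permOp e).symm ψ) σ = ψ (e.symm σ) := rfl

/-- The projection onto the configurations whose spin at site `j` equals `a`. -/
def projOp {d : ℕ} (j : ℤ) (a : Fin d) : Hilb d →L[ℂ] Hilb d :=
  have hle : ∀ (ψ : Hilb d) (σ : ℤ → Fin d),
      ‖if σ j = a then ψ σ else 0‖ ^ (2 : ℝ≥0∞).toReal ≤ ‖ψ σ‖ ^ (2 : ℝ≥0∞).toReal := by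
    intro ψ σ
    split_ifs <;> simp
  have hsum : ∀ ψ : Hilb d,
      Summable fun σ => ‖if σ j = a then ψ σ else 0‖ ^ (2 : ℝ≥0∞).toReal := fun ψ =>
    Summable.of_nonneg_of_le (fun _ => by positivity) (hle ψ)
      ((lp.memℓp ψ).summable (by norm_num))
  LinearMap.mkContinuous
    { toFun := fun ψ => ⟨fun σ => if σ j = a then ψ σ else 0, memℓp_gen (hsum ψ)⟩
      map_add' := fun ψ φ => Subtype.ext <| funext fun σ => by
        change (if σ j = a then ψ σ + φ σ else 0) =
          (if σ j = a then ψ σ else 0) + (if σ j = a then φ σ else 0)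
        split_ifs <;> simp
      map_smul' := fun c ψ => Subtype.ext <| funext fun σ => by
        change (if σ j = a then c * ψ σ else 0) = c * (if σ j = a then ψ σ else 0)
        split_ifs <;> simp }
    1
    (fun ψ => by
      have h2 : 0 < (2 : ℝ≥0∞).toReal := by norm_num
      rw [one_mul]
      refine lp.norm_le_of_tsum_le h2 (norm_nonneg _) ?_
      rw [lp.norm_rpow_eq_tsum h2 ψ]
      exact (hsum ψ).tsum_le_tsum (hle ψ) ((lp.memℓp ψ).summable h2))

@[simp] theorem projOp_apply {d : ℕ} (j : ℤ) (a : Fin d) (ψ : Hilb d) (σ : ℤ → Fin d) :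
    (projOp j a ψ) σ = if σ j = a then ψ σ else 0 := rfl

/-- Interchange of the spin values `a` and `b` at site `j`. -/
def swapAt {d : ℕ} (j : ℤ) (a b : Fin d) : Equiv.Perm (ℤ → Fin d) :=
  Equiv.piCongrRight (fun k => if k = j then Equiv.swap a b else Equiv.refl _)

/-- The matrix `x` acting at site `j`; see `siteOp_apply`. -/
def siteOp {d : ℕ} (j : ℤ) (x : Matrix (Fin d) (Fin d) ℂ) : Hilb d →L[ℂ] Hilb d :=
  ∑ a, ∑ b, x a b • (projOp j a ∘L (permOp (swapAt j a b) : Hilb d →L[ℂ] Hilb d))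

/-- `x` acts by its matrix elements on the spin at site `j`, and trivially elsewhere. -/
theorem siteOp_apply {d : ℕ} (j : ℤ) (x : Matrix (Fin d) (Fin d) ℂ) (ψ : Hilb d)
    (σ : ℤ → Fin d) :
    (siteOp j x ψ) σ = ∑ b, x (σ j) b * ψ (Function.update σ j b) := by
  have key : ∀ b, swapAt j (σ j) b σ = Function.update σ j b := by
    intro b
    funext k
    by_cases hk : k = j
    · subst hk; simp [swapAt]
    · simp [swapAt, hk]
  simp only [siteOp, sum_apply, smul_apply,
    ContinuousLinearMap.comp_apply, lp.coeFn_sum, lp.coeFn_smul, Finset.sum_apply, Pi.smul_apply,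
    projOp_apply, smul_eq_mul]
  rw [Finset.sum_eq_single (σ j)]
  · refine Finset.sum_congr rfl fun b _ => ?_
    rw [if_pos rfl]
    exact congrArg (fun τ => x (σ j) b * ψ τ) (key b)
  · intro a _ ha
    exact Finset.sum_eq_zero fun b _ => by rw [if_neg (Ne.symm ha), mul_zero]
  · simp

/-- The *-algebra of strictly local operators: all polynomials in the single-site operators. -/
def localAlg (d : ℕ) : StarSubalgebra ℂ (Hilb d →L[ℂ] Hilb d) :=
  StarAlgebra.adjoin ℂ {T | ∃ (j : ℤ) (x : Matrix (Fin d) (Fin d) ℂ), T = siteOp j x}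

/-- The quasi-local C*-algebra `𝒜` of the chain: the norm closure of the local operators. -/
def QuasiLocal (d : ℕ) : Type := (localAlg d).topologicalClosure

/-- The C*-algebra structure that `𝒜` inherits from the bounded operators. -/
def quasiLocalCStarAlgebra (d : ℕ) : CStarAlgebra (QuasiLocal d) :=
  StarSubalgebra.cstarAlgebra (h_closed := (localAlg d).isClosed_topologicalClosure)
    (localAlg d).topologicalClosure

instance (d : ℕ) : CStarAlgebra (QuasiLocal d) := quasiLocalCStarAlgebra d

/-- The embedding `x ↦ x^{(j)}` of the single-site matrices at site `j` into `𝒜`. -/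
def site {d : ℕ} (j : ℤ) (x : Matrix (Fin d) (Fin d) ℂ) : QuasiLocal d :=
  ⟨siteOp j x, (localAlg d).le_topologicalClosure
    (StarAlgebra.subset_adjoin ℂ _ ⟨j, x, rfl⟩)⟩

/-! ## Translations -/

/-- The shift of configurations, `(shift n σ) k = σ (k + n)`. -/
def shift {d : ℕ} (n : ℤ) : Equiv.Perm (ℤ → Fin d) :=
  Equiv.arrowCongr (Equiv.addRight (-n)) (Equiv.refl (Fin d))

@[simp] theorem shift_apply {d : ℕ} (n : ℤ) (σ : ℤ → Fin d) (k : ℤ) :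
    shift n σ k = σ (k + n) := by
  simp [shift]

theorem conj_siteOp {d : ℕ} (n j : ℤ) (x : Matrix (Fin d) (Fin d) ℂ) :
    (permOp (shift n)).conjStarAlgEquiv (siteOp j x) = siteOp (j + n) x := by
  ext ψ σ
  have h : ∀ b, (shift n).symm (Function.update (shift n σ) j b)
      = Function.update σ (j + n) b := by
    intro b
    rw [Equiv.symm_apply_eq]
    funext k
    by_cases hk : k = j
    · subst hk; simp
    · simp [Function.update_of_ne, hk]
  rw [LinearIsometryEquiv.conjStarAlgEquiv_apply_apply, permOp_apply, siteOp_apply, siteOp_apply]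
  simp [h]

theorem conj_mem {d : ℕ} (n : ℤ) (a : Hilb d →L[ℂ] Hilb d)
    (ha : a ∈ (localAlg d).topologicalClosure) :
    (permOp (shift n)).conjStarAlgEquiv a ∈ (localAlg d).topologicalClosure := by
  set Φ : (Hilb d →L[ℂ] Hilb d) →⋆ₐ[ℂ] (Hilb d →L[ℂ] Hilb d) :=
    (permOp (d := d) (shift n)).conjStarAlgEquiv.toStarAlgHom with hΦ
  have hloc : localAlg d ≤ (localAlg d).comap Φ := by
    refine StarAlgebra.adjoin_le ?_
    rintro _ ⟨j, x, rfl⟩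
    change (permOp (shift n)).conjStarAlgEquiv (siteOp j x) ∈ localAlg d
    rw [conj_siteOp]
    exact StarAlgebra.subset_adjoin ℂ _ ⟨j + n, x, rfl⟩
  have hcont : Continuous Φ := by
    change Continuous (fun a => (permOp (d := d) (shift n)).conjStarAlgEquiv a)
    simp only [LinearIsometryEquiv.conjStarAlgEquiv_apply]
    fun_prop
  exact map_mem_closure hcont ha (fun b hb => hloc hb)

/-- The `n`-th power `τⁿ` of the translation, for `n ∈ ℤ`: the *-endomorphism of `𝒜` implemented
by the unitary shift, determined by `τⁿ (x^{(j)}) = x^{(j+n)}` (see `translate_site`). -/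
def translate {d : ℕ} (n : ℤ) : QuasiLocal d →⋆ₐ[ℂ] QuasiLocal d :=
  StarAlgHom.codRestrict
    ((permOp (d := d) (shift n)).conjStarAlgEquiv.toStarAlgHom.comp
      (localAlg d).topologicalClosure.subtype)
    (localAlg d).topologicalClosure (fun a => conj_mem n a.1 a.2)

theorem translate_site {d : ℕ} (n j : ℤ) (x : Matrix (Fin d) (Fin d) ℂ) :
    translate n (site j x) = site (j + n) x :=
  Subtype.ext (conj_siteOp n j x)

/-! ## States -/

/-- Positive normalised linear functionals. -/
structure IsState {d : ℕ} (ω : QuasiLocal d →ₗ[ℂ] ℂ) : Prop where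
  nonneg : ∀ a : QuasiLocal d, 0 ≤ ω (star a * a)
  normalised : ω 1 = 1

def IsTranslationInvariant {d : ℕ} (ω : QuasiLocal d →ₗ[ℂ] ℂ) : Prop :=
  ∀ a : QuasiLocal d, ω (translate 1 a) = ω a

/-- `lim_{n → ±∞} ω(a† τⁿ(b) c) = ω(a† c) ω(b)` for all `a, b, c ∈ 𝒜`. -/
def IsClustering {d : ℕ} (ω : QuasiLocal d →ₗ[ℂ] ℂ) : Prop :=
  ∀ a b c : QuasiLocal d,
    Tendsto (fun n : ℤ => ω (star a * translate n b * c)) atTop (𝓝 (ω (star a * c) * ω b)) ∧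
    Tendsto (fun n : ℤ => ω (star a * translate n b * c)) atBot (𝓝 (ω (star a * c) * ω b))

/-! ## The microscopic mean-field dissipative dynamics -/

/-- The parameters of the microscopic dynamics: a hermitian orthonormal basis of `M_d(ℂ)`, real
coefficients `ε`, a hermitian matrix `h` and a positive semi-definite (Kossakowski) matrix `C`. -/
structure Model (d : ℕ) where
  v : Fin (d ^ 2) → Matrix (Fin d) (Fin d) ℂ
  v_herm : ∀ μ, (v μ).IsHermitian
  v_orth : ∀ μ ν, (v μ * v ν).trace = if μ = ν then 1 else 0
  ε : Fin (d ^ 2) → ℝ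
  h : Matrix (Fin (d ^ 2)) (Fin (d ^ 2)) ℂ
  h_herm : h.IsHermitian
  C : Matrix (Fin (d ^ 2)) (Fin (d ^ 2)) ℂ
  C_pos : C.PosSemidef

/-- `∑_{k=0}^{N-1} x^{(k)}`. -/
def siteSum {d : ℕ} (N : ℕ) (x : Matrix (Fin d) (Fin d) ℂ) : QuasiLocal d :=
  ∑ k ∈ Finset.range N, site (k : ℤ) x

/-- The mean-field operator `X^{(N)} = (1/N) ∑_{k=0}^{N-1} x^{(k)}`. -/
def meanField {d : ℕ} (N : ℕ) (x : Matrix (Fin d) (Fin d) ℂ) : QuasiLocal d :=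
  (N : ℂ)⁻¹ • siteSum N x

/-- The commutator `y ↦ [a, y]`, as a bounded operator on `𝒜`. -/
def ad {d : ℕ} (a : QuasiLocal d) : QuasiLocal d →L[ℂ] QuasiLocal d :=
  ContinuousLinearMap.mul ℂ (QuasiLocal d) a - (ContinuousLinearMap.mul ℂ (QuasiLocal d)).flip a

namespace Model

variable {d : ℕ} (M : Model d)

/-- The free and the mean-field hamiltonian
`∑_μ ε_μ ∑_k v_μ^{(k)} + ∑_{μν} h_{μν} (1/N) ∑_k v_μ^{(k)} ∑_ℓ v_ν^{(ℓ)}`. -/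
def hamiltonian (N : ℕ) : QuasiLocal d :=
  ∑ μ, (M.ε μ : ℂ) • siteSum N (M.v μ) +
    ∑ μ, ∑ ν, M.h μ ν • ((N : ℂ)⁻¹ • (siteSum N (M.v μ) * siteSum N (M.v ν)))

/-- `V_μ^{(N)} = N^{-1/2} ∑_{k=0}^{N-1} v_μ^{(k)}`. -/
def V (N : ℕ) (μ : Fin (d ^ 2)) : QuasiLocal d :=
  ((Real.sqrt N : ℝ) : ℂ)⁻¹ • siteSum N (M.v μ)

/-- The Lindblad generator `𝕃^{(N)}` as a bounded operator on `𝒜`; see `lindblad_apply`. -/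
def lindblad (N : ℕ) : QuasiLocal d →L[ℂ] QuasiLocal d :=
  Complex.I • ad (M.hamiltonian N) +
    ∑ μ, ∑ ν, (M.C μ ν / 2) •
      ((ContinuousLinearMap.mul ℂ (QuasiLocal d)).flip (M.V N ν) ∘L ad (M.V N μ) -
        ContinuousLinearMap.mul ℂ (QuasiLocal d) (M.V N μ) ∘L ad (M.V N ν))

theorem lindblad_apply (N : ℕ) (x : QuasiLocal d) :
    M.lindblad N x =
      Complex.I • ⁅M.hamiltonian N, x⁆ +
        ∑ μ, ∑ ν, (M.C μ ν / 2) •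
          (⁅M.V N μ, x⁆ * M.V N ν + M.V N μ * ⁅x, M.V N ν⁆) := by
  simp only [lindblad, ad, add_apply, smul_apply,
    sum_apply, sub_apply, ContinuousLinearMap.comp_apply,
    ContinuousLinearMap.mul_apply', ContinuousLinearMap.flip_apply, Ring.lie_def]
  congr 1
  refine Finset.sum_congr rfl fun μ _ => Finset.sum_congr rfl fun ν _ => ?_
  congr 1
  noncomm_ring

/-- The semigroup `γ_t^{(N)} = exp(t 𝕃^{(N)})`. -/
def γ (N : ℕ) (t : ℝ) : QuasiLocal d →L[ℂ] QuasiLocal d :=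
  NormedSpace.exp ((t : ℂ) • M.lindblad N)

/-- `ω(γ_t^{(N)}[(1/N) ∑_{k=0}^{N-1} x^{(k)}])`. -/
def macroAvg (ω : QuasiLocal d →ₗ[ℂ] ℂ) (N : ℕ) (t : ℝ) (x : Matrix (Fin d) (Fin d) ℂ) : ℂ :=
  ω (M.γ N t (meanField N x))

/-! ## The coefficients of the macroscopic equations of motion -/

/-- `B̃ = B + 2 i h^{(re)}`, where `B = (C - Cᵀ)/2` and `h^{(re)}` is the entrywise real part
of `h`. -/
def Btilde : Matrix (Fin (d ^ 2)) (Fin (d ^ 2)) ℂ :=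
  Matrix.of fun μ ν => (M.C μ ν - M.C ν μ) / 2 + 2 * Complex.I * ((M.h μ ν).re : ℂ)

/-- The structure constants `J γ α β = J^γ_{αβ} = Tr([v_α, v_β] v_γ)`. -/
def J (γ α β : Fin (d ^ 2)) : ℂ := (⁅M.v α, M.v β⁆ * M.v γ).trace

/-- `D(r)_{αβ} = ∑_{μν} J^μ_{αβ} B̃_{μν} r_ν + i ∑_μ ε_μ J^μ_{αβ}`. -/
def D (r : Fin (d ^ 2) → ℝ) : Matrix (Fin (d ^ 2)) (Fin (d ^ 2)) ℂ :=
  Matrix.of fun α β =>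
    ∑ μ, ∑ ν, M.J μ α β * M.Btilde μ ν * (r ν : ℂ) +
      Complex.I * ∑ μ, (M.ε μ : ℂ) * M.J μ α β

/-- The single-site hamiltonian `-i ∑_μ (∑_ν B̃_{μν} r_ν + i ε_μ) v_μ`. -/
def siteHam (r : Fin (d ^ 2) → ℝ) : Matrix (Fin d) (Fin d) ℂ :=
  (-Complex.I) • ∑ μ, (∑ ν, M.Btilde μ ν * (r ν : ℂ) + Complex.I * (M.ε μ : ℂ)) • M.v μ

end Model

end MeanFieldChain

end

/-!
The generator `𝕃^{(N)}` maps each mean-field operator `m_α = V_α^{(N)} / √N` to a quadratic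
polynomial in the `m_β` whose coefficients do not depend on `N` (`lindblad_meanField`), and on the
squares of mean-field operators it obeys the Leibniz rule up to `O(1/N)`
(`norm_leibniz_meanField_le`). If the `m_β` were commuting numbers, they would evolve by the
ordinary differential equation `r' = D(r) r`, which has the same coefficients (`velocity_eq_poly`,
`velocity_eq_mulVec`).

To compare the two at all times, consider the mean square deviation
`φ(γ_t[∑_α (m_α - r_α(t))²])` for the positive functional `φ = ω(b† · b)`. The semigroup `γ_t` is
positive, as `𝕃^{(N)}` is of Lindblad form (`exp_lindblad_nonneg`), so `φ ∘ γ_t` obeys the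
Cauchy–Schwarz inequality. With it the time derivative of the deviation is bounded by a multiple of
the deviation plus `O(1/N)`, and Grönwall's lemma bounds the deviation at time `t` by `e^{Kt}` times
its initial value plus `O(1/N)` (`deviation_le`). The initial value tends to zero if
`r_α(0) = ω(v_α^{(0)})`: this is the law of large numbers for a translation-invariant clustering
state, extended to the vectors `b Ω` because mean-field operators asymptotically commute with `𝒜`
in norm (`tendsto_deviation`). The Cauchy–Schwarz inequality and polarisation then give the limit
of `ω(a γ_t[m_α] b)`.

The trajectory `r` is obtained together with the unitaries `U_t`, from the single equation
`U' = -i H(r(U)) U` with `r_α(U) = ω((U† v_α U)^{(0)})`. Its solutions exist globally because they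
stay in the compact unitary group (`exists_flow`), and Heisenberg's equation for `U† v_α U` is the
macroscopic equation of motion (`apply_rotated_commutator`).
-/

noncomputable section

namespace MeanFieldChain

/-! ### Positive maps and positive functionals on C*-algebras -/

section Positivity

variable {A : Type*} [CStarAlgebra A]

theorem exp_apply_eq_self {T : A →L[ℂ] A} {x : A} (h : T x = 0) : NormedSpace.exp T x = x := by
  have hs := (NormedSpace.exp_series_hasSum_exp' (𝕂 := ℂ) T).mapL
    (ContinuousLinearMap.apply ℂ A x)
  refine hs.unique ?_
  have h0 : ∀ n : ℕ, n ≠ 0 →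
      (ContinuousLinearMap.apply ℂ A x) (((n.factorial : ℂ)⁻¹) • T ^ n) = 0 := by
    intro n hn
    obtain ⟨k, rfl⟩ := Nat.exists_eq_succ_of_ne_zero hn
    simp [pow_succ, h]
  simpa using hasSum_single 0 h0

theorem isSelfAdjoint_sub_real {a : A} (ha : IsSelfAdjoint a) (r : ℝ) :
    IsSelfAdjoint (a - algebraMap ℂ A r) := by
  refine ha.sub ?_
  rw [isSelfAdjoint_iff, ← algebraMap_star_comm, Complex.star_def, Complex.conj_ofReal]

variable [PartialOrder A] [StarOrderedRing A]

theorem exp_apply_nonneg {T : A →L[ℂ] A} (hT : ∀ x, 0 ≤ x → 0 ≤ T x) {x : A} (hx : 0 ≤ x) :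
    0 ≤ NormedSpace.exp T x := by
  have hs := (NormedSpace.exp_series_hasSum_exp' (𝕂 := ℂ) T).mapL
    (ContinuousLinearMap.apply ℂ A x)
  refine hs.nonneg fun n => ?_
  have hp : ∀ k : ℕ, 0 ≤ (T ^ k) x := by
    intro k
    induction k with
    | zero => simpa using hx
    | succ k ih => rw [pow_succ']; exact hT _ ih
  have : (0 : ℂ) ≤ (n.factorial : ℂ)⁻¹ := by positivity
  simpa using smul_nonneg this (hp n)

/-- A map `x ↦ Y† x + x Y + Φ x` with `Φ` positive generates a positive semigroup: adding
`ε Y† x Y` to it gives `ε⁻¹ ((1 + ε Y)† x (1 + ε Y) - x) + Φ x`, a positive map minus a scalar,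
whose exponential is positive; then `ε → 0`. -/
theorem exp_lindblad_nonneg {L Φ : A →L[ℂ] A} {Y : A} (hΦ : ∀ x, 0 ≤ x → 0 ≤ Φ x)
    (hL : ∀ x, L x = star Y * x + x * Y + Φ x) {x : A} (hx : 0 ≤ x) :
    0 ≤ NormedSpace.exp L x := by
  let _ : NormedAlgebra ℚ (A →L[ℂ] A) := NormedAlgebra.restrictScalars ℚ ℂ _
  set Ψ : A →L[ℂ] A := ContinuousLinearMap.mulLeftRight ℂ A (star Y) Y with hΨ
  have hΨa : ∀ z, Ψ z = star Y * z * Y := fun z => rfl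
  have key : ∀ ε : ℝ, 0 < ε → 0 ≤ NormedSpace.exp (L + (ε : ℂ) • Ψ) x := by
    intro ε hε
    have hε' : (ε : ℂ) ≠ 0 := by exact_mod_cast hε.ne'
    set S : A →L[ℂ] A := ContinuousLinearMap.mulLeftRight ℂ A
      (star (1 + (ε : ℂ) • Y)) (1 + (ε : ℂ) • Y) with hS
    have hSa : ∀ z, S z = star (1 + (ε : ℂ) • Y) * z * (1 + (ε : ℂ) • Y) := fun z => rfl
    have hdec : L + (ε : ℂ) • Ψ = algebraMap ℂ (A →L[ℂ] A) (-(ε : ℂ)⁻¹) +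
        ((ε : ℂ)⁻¹ • S + Φ) := by
      ext z
      simp only [add_apply, smul_apply, hL, hΨa, hSa, Algebra.algebraMap_eq_smul_one,
        neg_apply, one_apply_eq_self, star_add, star_one, star_smul, Complex.star_def,
        Complex.conj_ofReal, add_mul, mul_add, one_mul, mul_one, smul_add, smul_mul_assoc,
        mul_smul_comm, smul_smul, inv_mul_cancel₀ hε', one_smul, neg_smul]
      rw [show (ε : ℂ)⁻¹ * ((ε : ℂ) * ε) = ε by field_simp]
      abel
    rw [hdec, NormedSpace.exp_add_of_commute (Algebra.commutes _ _),
      ← NormedSpace.algebraMap_exp_comm, Algebra.algebraMap_eq_smul_one, smul_mul_assoc, one_mul,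
      smul_apply]
    refine smul_nonneg ?_ (exp_apply_nonneg (fun z hz => ?_) hx)
    · rw [← Complex.exp_eq_exp_ℂ, ← Complex.ofReal_inv, ← Complex.ofReal_neg,
        ← Complex.ofReal_exp]
      exact_mod_cast (Real.exp_pos _).le
    · have h1 : (0 : ℂ) ≤ (ε : ℂ)⁻¹ := by
        rw [← Complex.ofReal_inv]; exact_mod_cast (inv_pos.mpr hε).le
      rw [add_apply, smul_apply, hSa]
      exact add_nonneg (smul_nonneg h1 (star_left_conjugate_nonneg hz _)) (hΦ z hz)
  have hlim : Tendsto (fun ε : ℝ => NormedSpace.exp (L + (ε : ℂ) • Ψ) x) (𝓝[>] 0)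
      (𝓝 (NormedSpace.exp L x)) := by
    have hc : Continuous fun ε : ℝ => NormedSpace.exp (L + (ε : ℂ) • Ψ) x := by
      have : Continuous fun ε : ℝ => L + (ε : ℂ) • Ψ := by fun_prop
      exact (NormedSpace.exp_continuous.comp this).clm_apply continuous_const
    have := hc.tendsto 0
    rw [show L + ((0 : ℝ) : ℂ) • Ψ = L by ext z; simp] at this
    exact this.mono_left nhdsWithin_le_nhds
  exact ge_of_tendsto hlim (eventually_nhdsWithin_of_forall key)

/-- Left multiplication by `g` is bounded by `‖g‖` in the seminorm `φ (b† b) ^ (1/2)`. -/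
theorem norm_toPreGNS_mul_le (φ : A →ₚ[ℂ] ℂ) (g b : A) :
    ‖φ.toPreGNS (g * b)‖ ≤ ‖g‖ * ‖φ.toPreGNS b‖ := by
  have h3 := (φ.leftMulMapPreGNS g).le_opNorm (φ.toPreGNS b)
  have h4 : ‖φ.leftMulMapPreGNS g‖ ≤ ‖g‖ := LinearMap.mkContinuous_norm_le _ (norm_nonneg _) _
  exact h3.trans (by gcongr)

/-- The Cauchy–Schwarz inequality of a positive functional, with a bounded operator inserted. -/
theorem norm_apply_star_mul_mul_le (φ : A →ₚ[ℂ] ℂ) (a g b : A) :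
    ‖φ (star a * (g * b))‖ ≤ ‖φ.toPreGNS a‖ * (‖g‖ * ‖φ.toPreGNS b‖) := by
  have h1 := norm_inner_le_norm (𝕜 := ℂ) (φ.toPreGNS a) (φ.toPreGNS (g * b))
  have h2 := norm_toPreGNS_mul_le φ g b
  rw [PositiveLinearMap.preGNS_inner_def] at h1
  exact h1.trans (by gcongr)

theorem re_apply_star_mul_self (φ : A →ₚ[ℂ] ℂ) (a : A) :
    (φ (star a * a)).re = ‖φ.toPreGNS a‖ ^ 2 := by
  have := φ.preGNS_norm_sq (φ.toPreGNS a)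
  simp only [PositiveLinearMap.ofPreGNS_toPreGNS] at this
  rw [← this]
  norm_cast

theorem norm_apply_le (φ : A →ₚ[ℂ] ℂ) (a : A) : ‖φ a‖ ≤ ‖a‖ * (φ 1).re := by
  have h := norm_apply_star_mul_mul_le φ 1 a 1
  have h1 := re_apply_star_mul_self φ 1
  simp only [star_one, one_mul, mul_one] at h h1
  rw [h1]
  linarith [sq ‖φ.toPreGNS 1‖]

end Positivity

/-! ### Grönwall's estimate for the mean square deviation -/

section Variance

variable {A : Type*} [CStarAlgebra A] [PartialOrder A] [StarOrderedRing A]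

/-- The precomposition of a positive functional with a positive bounded map. -/
def compPositive (φ : A →ₚ[ℂ] ℂ) (T : A →L[ℂ] A) (hT : ∀ x, 0 ≤ x → 0 ≤ T x) : A →ₚ[ℂ] ℂ :=
  .mk₀ (φ.toLinearMap ∘ₗ T.toLinearMap) fun x hx => φ.map_nonneg (hT x hx)

@[simp] theorem compPositive_apply (φ : A →ₚ[ℂ] ℂ) (T : A →L[ℂ] A)
    (hT : ∀ x, 0 ≤ x → 0 ≤ T x) (x : A) : compPositive φ T hT x = φ (T x) := rfl

/-- The functional `x ↦ φ (b† x b)`. -/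
def conjFunctional (φ : A →ₚ[ℂ] ℂ) (b : A) : A →ₚ[ℂ] ℂ :=
  compPositive φ (ContinuousLinearMap.mulLeftRight ℂ A (star b) b)
    fun _ hx => star_left_conjugate_nonneg hx b

@[simp] theorem conjFunctional_apply (φ : A →ₚ[ℂ] ℂ) (b x : A) :
    conjFunctional φ b x = φ (star b * x * b) := rfl

variable {ι : Type*} [Fintype ι]

/-- The sum of the squared deviations of the `m i` from the numbers `r i`. -/
def deviation (m : ι → A) (r : ι → ℝ) : A :=
  ∑ i, (m i - algebraMap ℂ A (r i)) * (m i - algebraMap ℂ A (r i))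

theorem re_apply_deviation (φ : A →ₚ[ℂ] ℂ) {m : ι → A} (hm : ∀ i, IsSelfAdjoint (m i))
    (r : ι → ℝ) : (φ (deviation m r)).re =
      ∑ i, ‖φ.toPreGNS (m i - algebraMap ℂ A (r i))‖ ^ 2 := by
  simp only [deviation, map_sum, Complex.re_sum]
  refine Finset.sum_congr rfl fun i _ => ?_
  rw [← re_apply_star_mul_self, (isSelfAdjoint_sub_real (hm i) (r i)).star_eq]

variable (P : ι → ι → ι → ℂ) (p : ι → ι → ℂ)

/-- The growth rate in `deviation_le`, for operators `m i` of norm at most `R` whose generator acts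
by `L (m i) = ∑ P i j k m_j m_k + ∑ p i j m_j`. -/
def deviationRate (R : ℝ) : ℝ :=
  ∑ i, 2 * (∑ j, ∑ k, ‖P i j k‖ * (2 * R) + ∑ j, ‖p i j‖)

/-- The drift of the mean square deviation. With `δ = m - r`, the difference `m_j m_k - r_j r_k`
equals both `m_j δ_k + r_k δ_j` and `δ_j m_k + r_j δ_k`, so `δ_i (L m_i - r'_i)` and
`(L m_i - r'_i) δ_i` are sums of products `δ g δ` with bounded `g`, which the Cauchy–Schwarz
inequality controls by the deviation itself. -/
theorem deviation_drift_le (ψ : A →ₚ[ℂ] ℂ) {L : A →L[ℂ] A} (hL1 : L 1 = 0) {m : ι → A}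
    (hm : ∀ i, IsSelfAdjoint (m i))
    (hLm : ∀ i, L (m i) = ∑ j, ∑ k, P i j k • (m j * m k) + ∑ j, p i j • m j)
    {c R : ℝ} (hc : ∀ i, ‖L (m i * m i) - L (m i) * m i - m i * L (m i)‖ ≤ c)
    (hR : ∀ i, ‖m i‖ ≤ R) {r r' : ι → ℝ} (hrR : ∀ i, |r i| ≤ R)
    (hr' : ∀ i, (r' i : ℂ) = ∑ j, ∑ k, P i j k * (r j * r k) + ∑ j, p i j * r j) :
    (ψ (L (deviation m r) - ∑ i, (r' i : ℂ) • ((m i - algebraMap ℂ A (r i)) +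
      (m i - algebraMap ℂ A (r i))))).re ≤
      deviationRate P p R * (ψ (deviation m r)).re + Fintype.card ι * c * (ψ 1).re := by
  set δ : ι → A := fun i => m i - algebraMap ℂ A (r i) with hδ
  have hδs : ∀ i, star (δ i) = δ i := fun i => (isSelfAdjoint_sub_real (hm i) (r i)).star_eq
  set S : ℝ := (ψ (deviation m r)).re with hS
  have hSsum : S = ∑ i, ‖ψ.toPreGNS (δ i)‖ ^ 2 := re_apply_deviation ψ hm r
  have hle : ∀ i, ‖ψ.toPreGNS (δ i)‖ ^ 2 ≤ S := fun i => by
    rw [hSsum]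
    exact Finset.single_le_sum (f := fun i => ‖ψ.toPreGNS (δ i)‖ ^ 2)
      (fun _ _ => sq_nonneg _) (Finset.mem_univ i)
  have hprod : ∀ i j, ‖ψ.toPreGNS (δ i)‖ * ‖ψ.toPreGNS (δ j)‖ ≤ S := fun i j => by
    nlinarith [hle i, hle j, sq_nonneg (‖ψ.toPreGNS (δ i)‖ - ‖ψ.toPreGNS (δ j)‖)]
  have hbd : ∀ i g j, ‖g‖ ≤ R → ‖ψ (δ i * (g * δ j))‖ ≤ R * S := fun i g j hg => by
    have h := norm_apply_star_mul_mul_le ψ (δ i) g (δ j)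
    rw [hδs] at h
    refine h.trans ?_
    calc _ = ‖g‖ * (‖ψ.toPreGNS (δ i)‖ * ‖ψ.toPreGNS (δ j)‖) := by ring
      _ ≤ R * S := by
        have := hprod i j
        have h0 := (norm_nonneg g).trans hg
        gcongr
  have hbd1 : ∀ i j, ‖ψ (δ i * δ j)‖ ≤ S := fun i j => by
    have h := norm_inner_le_norm (𝕜 := ℂ) (ψ.toPreGNS (δ i)) (ψ.toPreGNS (δ j))
    rw [PositiveLinearMap.preGNS_inner_def] at h
    simp only [PositiveLinearMap.ofPreGNS_toPreGNS, hδs] at h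
    exact h.trans (hprod i j)
  -- the velocity of `δ i`, factorised through the deviations
  set w : ι → A := fun i => L (m i) - algebraMap ℂ A (r' i) with hw
  -- deviations on the right, to be multiplied by `δ i` from the left
  have hwl : ∀ i, w i = ∑ j, ∑ k, P i j k • (m j * δ k + (r k : ℂ) • δ j) +
      ∑ j, p i j • δ j := by
    intro i
    simp only [hw, hδ, hLm, hr', map_add, map_sum, map_mul, Algebra.algebraMap_eq_smul_one,
      add_sub_add_comm, ← Finset.sum_sub_distrib]
    congr 1 <;> refine Finset.sum_congr rfl fun j _ => ?_
    · refine Finset.sum_congr rfl fun k _ => ?_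
      simp only [mul_sub, mul_smul_comm, mul_one]
      module
    · simp only [smul_sub, smul_smul, smul_mul_assoc, one_mul]
  -- deviations on the left, to be multiplied by `δ i` from the right
  have hwr : ∀ i, w i = ∑ j, ∑ k, P i j k • (δ j * m k + (r j : ℂ) • δ k) +
      ∑ j, p i j • δ j := by
    intro i
    simp only [hw, hδ, hLm, hr', map_add, map_sum, map_mul, Algebra.algebraMap_eq_smul_one,
      add_sub_add_comm, ← Finset.sum_sub_distrib]
    congr 1 <;> refine Finset.sum_congr rfl fun j _ => ?_
    · refine Finset.sum_congr rfl fun k _ => ?_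
      simp only [sub_mul, smul_sub, smul_add, smul_smul, smul_mul_assoc, one_mul]
      abel
    · simp only [smul_sub, smul_smul, smul_mul_assoc, one_mul]
  have hb1 : ∀ i, ‖ψ (δ i * w i)‖ ≤
      (∑ j, ∑ k, ‖P i j k‖ * (2 * R) + ∑ j, ‖p i j‖) * S := by
    intro i
    rw [hwl]
    simp only [mul_add, Finset.mul_sum, map_add, map_sum, mul_smul_comm, smul_add, map_smul,
      add_mul, Finset.sum_mul]
    refine (norm_add_le _ _).trans (add_le_add ?_ ?_)
    · refine norm_sum_le_of_le _ fun j _ => norm_sum_le_of_le _ fun k _ => ?_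
      refine (norm_add_le _ _).trans ?_
      rw [norm_smul, norm_smul, norm_smul, Complex.norm_real, Real.norm_eq_abs]
      have h1 := hbd i (m j) k (hR j)
      have h2 := mul_le_mul (hrR k) (hbd1 i j) (norm_nonneg _) ((abs_nonneg _).trans (hrR k))
      nlinarith [norm_nonneg (P i j k), mul_le_mul_of_nonneg_left h1 (norm_nonneg (P i j k)),
        mul_le_mul_of_nonneg_left h2 (norm_nonneg (P i j k))]
    · refine norm_sum_le_of_le _ fun j _ => ?_
      rw [norm_smul]
      exact mul_le_mul_of_nonneg_left (hbd1 i j) (norm_nonneg _)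
  have hb2 : ∀ i, ‖ψ (w i * δ i)‖ ≤
      (∑ j, ∑ k, ‖P i j k‖ * (2 * R) + ∑ j, ‖p i j‖) * S := by
    intro i
    rw [hwr]
    simp only [add_mul, Finset.sum_mul, map_add, map_sum, smul_mul_assoc, smul_add, map_smul,
      mul_assoc]
    refine (norm_add_le _ _).trans (add_le_add ?_ ?_)
    · refine norm_sum_le_of_le _ fun j _ => norm_sum_le_of_le _ fun k _ => ?_
      refine (norm_add_le _ _).trans ?_
      rw [norm_smul, norm_smul, norm_smul, Complex.norm_real, Real.norm_eq_abs]
      have h1 := hbd j (m k) i (hR k)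
      have h2 := mul_le_mul (hrR j) (hbd1 k i) (norm_nonneg _) ((abs_nonneg _).trans (hrR j))
      nlinarith [norm_nonneg (P i j k), mul_le_mul_of_nonneg_left h1 (norm_nonneg (P i j k)),
        mul_le_mul_of_nonneg_left h2 (norm_nonneg (P i j k))]
    · refine norm_sum_le_of_le _ fun j _ => ?_
      rw [norm_smul]
      exact mul_le_mul_of_nonneg_left (hbd1 j i) (norm_nonneg _)
  -- the scalar terms of the square drop out because `L 1 = 0`
  have hdec : L (deviation m r) - ∑ i, (r' i : ℂ) • (δ i + δ i) =
      ∑ i, (δ i * w i + w i * δ i +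
        (L (m i * m i) - L (m i) * m i - m i * L (m i))) := by
    rw [deviation, map_sum, ← Finset.sum_sub_distrib]
    refine Finset.sum_congr rfl fun i _ => ?_
    have h1 : (m i - algebraMap ℂ A (r i)) * (m i - algebraMap ℂ A (r i)) =
        m i * m i - (r i : ℂ) • m i - (r i : ℂ) • m i + ((r i : ℂ) * r i) • (1 : A) := by
      simp only [Algebra.algebraMap_eq_smul_one, mul_sub, sub_mul, smul_mul_assoc, one_mul,
        mul_smul_comm, mul_one]
      module
    rw [h1]
    simp only [hw, hδ, map_add, map_sub, map_smul, hL1, smul_zero, add_zero, mul_sub, sub_mul,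
      Algebra.algebraMap_eq_smul_one, smul_mul_assoc, one_mul, mul_smul_comm, mul_one,
      smul_add, smul_sub, smul_smul, mul_comm (r i : ℂ) (r' i : ℂ)]
    abel
  rw [hdec, map_sum, Complex.re_sum]
  have hterm : ∀ i, (ψ (δ i * w i + w i * δ i +
        (L (m i * m i) - L (m i) * m i - m i * L (m i)))).re ≤
      2 * (∑ j, ∑ k, ‖P i j k‖ * (2 * R) + ∑ j, ‖p i j‖) * S + c * (ψ 1).re := by
    intro i
    have hψ1 : 0 ≤ (ψ 1).re := by
      have := re_apply_star_mul_self ψ 1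
      simp only [star_one, one_mul] at this
      rw [this]; positivity
    have h3 := (norm_apply_le ψ _).trans (mul_le_mul_of_nonneg_right (hc i) hψ1)
    have e1 := (Complex.re_le_norm _).trans (hb1 i)
    have e2 := (Complex.re_le_norm _).trans (hb2 i)
    have e3 := (Complex.re_le_norm _).trans h3
    rw [map_add, map_add, Complex.add_re, Complex.add_re]
    linarith
  refine (Finset.sum_le_sum fun i _ => hterm i).trans (le_of_eq ?_)
  rw [Finset.sum_add_distrib, ← Finset.sum_mul, deviationRate, Finset.sum_const, Finset.card_univ,
    nsmul_eq_mul]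
  ring

/-- The mean square deviation of the operators `m i` from a solution `r` of the ordinary
differential equation with the same coefficients as `L (m i)` grows at most exponentially, up to the
failure `c` of the Leibniz rule. -/
theorem deviation_le (φ : A →ₚ[ℂ] ℂ) {L : A →L[ℂ] A}
    (hpos : ∀ t : ℝ, 0 ≤ t → ∀ x, 0 ≤ x → 0 ≤ NormedSpace.exp ((t : ℂ) • L) x)
    (hL1 : L 1 = 0) {m : ι → A} (hm : ∀ i, IsSelfAdjoint (m i))
    (hLm : ∀ i, L (m i) = ∑ j, ∑ k, P i j k • (m j * m k) + ∑ j, p i j • m j)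
    {c R : ℝ} (hc0 : 0 ≤ c) (hR0 : 0 ≤ R)
    (hc : ∀ i, ‖L (m i * m i) - L (m i) * m i - m i * L (m i)‖ ≤ c)
    (hR : ∀ i, ‖m i‖ ≤ R) {r r' : ℝ → ι → ℝ} (hrR : ∀ t i, |r t i| ≤ R)
    (hr : ∀ t i, HasDerivAt (fun s => r s i) (r' t i) t)
    (hr' : ∀ t i, (r' t i : ℂ) =
      ∑ j, ∑ k, P i j k * (r t j * r t k) + ∑ j, p i j * r t j)
    {t : ℝ} (ht : 0 ≤ t) :
    (φ (NormedSpace.exp ((t : ℂ) • L) (deviation m (r t)))).re ≤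
      Real.exp (deviationRate P p R * t) *
        ((φ (deviation m (r 0))).re + Fintype.card ι * c * (φ 1).re * t) := by
  set K := deviationRate P p R with hK
  set B : ℝ := Fintype.card ι * c * (φ 1).re with hB
  set f : ℝ → ℝ := fun t => (φ (NormedSpace.exp ((t : ℂ) • L) (deviation m (r t)))).re with hf
  set f' : ℝ → ℝ := fun t => (φ (NormedSpace.exp ((t : ℂ) • L) (L (deviation m (r t)) -
    ∑ i, (r' t i : ℂ) • ((m i - algebraMap ℂ A (r t i)) +
      (m i - algebraMap ℂ A (r t i)))))).re with hf'
  have hderiv : ∀ t, HasDerivAt f (f' t) t := by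
    intro t
    have h1 : HasDerivAt (fun s : ℝ => NormedSpace.exp ((s : ℂ) • L))
        (NormedSpace.exp ((t : ℂ) • L) * L) t :=
      ((hasDerivAt_exp_smul_const (𝕂 := ℂ) L (t : ℂ)).scomp t
        Complex.ofRealCLM.hasDerivAt).congr_deriv (one_smul ℂ _)
    have h2 : HasDerivAt (fun s : ℝ => deviation m (r s))
        (-∑ i, (r' t i : ℂ) • ((m i - algebraMap ℂ A (r t i)) +
          (m i - algebraMap ℂ A (r t i)))) t := by
      have hδ : ∀ i, HasDerivAt (fun s => m i - algebraMap ℂ A (r s i))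
          (-((r' t i : ℂ) • (1 : A))) t := by
        intro i
        have := ((hr t i).ofReal_comp.smul_const (1 : A)).const_sub (m i)
        simpa only [Algebra.algebraMap_eq_smul_one] using this
      have := HasDerivAt.fun_sum (u := Finset.univ) fun i _ => (hδ i).mul (hδ i)
      refine this.congr_deriv ?_
      rw [← Finset.sum_neg_distrib]
      refine Finset.sum_congr rfl fun i _ => ?_
      simp only [neg_mul, mul_neg, smul_mul_assoc, one_mul, mul_smul_comm, mul_one, smul_add]
      abel
    have h3 := (((ContinuousLinearMap.restrictScalarsL ℂ A A ℝ ℝ).hasFDerivAt).comp_hasDerivAt t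
      h1).clm_apply h2
    let φc : A →L[ℂ] ℂ := ⟨φ.toLinearMap, map_continuous φ⟩
    have h4 := ((Complex.reCLM.comp (φc.restrictScalars ℝ)).hasFDerivAt).comp_hasDerivAt t h3
    refine h4.congr_deriv ?_
    simp only [hf', sub_eq_add_neg, map_add, map_neg]
    rfl
  have hbound : ∀ t, 0 ≤ t → f' t ≤ K * f t + B := by
    intro t ht
    have h := deviation_drift_le P p (compPositive φ (NormedSpace.exp ((t : ℂ) • L)) (hpos t ht))
      hL1 hm hLm hc hR (hrR t) (hr' t)
    have h1 : NormedSpace.exp ((t : ℂ) • L) 1 = 1 := exp_apply_eq_self (by simp [hL1])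
    simpa only [compPositive_apply, h1] using h
  have hψ1 : 0 ≤ (φ 1).re := by
    have := re_apply_star_mul_self φ 1
    simp only [star_one, one_mul] at this
    rw [this]; positivity
  have hB0 : 0 ≤ B := by positivity
  have hK0 : 0 ≤ K := by rw [hK, deviationRate]; positivity
  set g : ℝ → ℝ := fun t => Real.exp (-(K * t)) * f t - B * t with hg
  have hgd : ∀ t, HasDerivAt g
      (Real.exp (-(K * t)) * (-(K * 1)) * f t + Real.exp (-(K * t)) * f' t - B * 1) t := fun t =>
    ((((hasDerivAt_id t).const_mul K).neg.exp).mul (hderiv t)).sub ((hasDerivAt_id t).const_mul B)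
  have hanti : AntitoneOn g (Set.Ici 0) := by
    refine antitoneOn_of_deriv_nonpos (convex_Ici 0)
      (fun t _ => (hgd t).continuousAt.continuousWithinAt)
      (fun t _ => (hgd t).differentiableAt.differentiableWithinAt) fun t ht => ?_
    rw [interior_Ici] at ht
    have ht : 0 < t := ht
    rw [(hgd t).deriv]
    have h1 := mul_le_mul_of_nonneg_left (hbound t ht.le) (Real.exp_pos (-(K * t))).le
    have h2 : Real.exp (-(K * t)) ≤ 1 := Real.exp_le_one_iff.mpr (by
      have := mul_nonneg hK0 ht.le
      linarith)
    have h3 := mul_le_mul_of_nonneg_right h2 hB0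
    linarith
  -- compare the values of the decreasing function `g` at `0` and at `t`
  have h := hanti Set.self_mem_Ici (Set.mem_Ici.mpr ht) ht
  have h0 : g 0 = (φ (deviation m (r 0))).re := by
    have : ((0 : ℝ) : ℂ) • L = 0 := by ext; simp
    simp only [hg, hf, this]
    simp
  rw [h0] at h
  have h1 : Real.exp (-(K * t)) * f t ≤ (φ (deviation m (r 0))).re + B * t := by
    simp only [hg] at h
    linarith
  have h2 := mul_le_mul_of_nonneg_left h1 (Real.exp_pos (K * t)).le
  rwa [← mul_assoc, ← Real.exp_add, add_neg_cancel, Real.exp_zero, one_mul] at h2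

end Variance

/-! ### Single-site operators -/

section Site

variable {d : ℕ}

theorem siteOp_mul (j : ℤ) (x y : Matrix (Fin d) (Fin d) ℂ) :
    siteOp j (x * y) = siteOp j x * siteOp j y := by
  ext ψ σ
  rw [mul_apply_eq_comp, siteOp_apply, siteOp_apply]
  simp only [siteOp_apply, Matrix.mul_apply, Function.update_self, Function.update_idem,
    Finset.sum_mul, Finset.mul_sum, mul_assoc]
  rw [Finset.sum_comm]

theorem siteOp_one (j : ℤ) : siteOp (d := d) j 1 = 1 := by
  ext ψ σ
  rw [siteOp_apply]
  simp [Matrix.one_apply]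

theorem siteOp_commute {j k : ℤ} (h : j ≠ k) (x y : Matrix (Fin d) (Fin d) ℂ) :
    siteOp j x * siteOp k y = siteOp k y * siteOp j x := by
  ext ψ σ
  rw [mul_apply_eq_comp, siteOp_apply, mul_apply_eq_comp, siteOp_apply]
  simp only [siteOp_apply, Finset.mul_sum, Function.update_of_ne h, Function.update_of_ne h.symm]
  rw [Finset.sum_comm]
  refine Finset.sum_congr rfl fun b _ => Finset.sum_congr rfl fun a _ => ?_
  rw [Function.update_comm h]
  ring

theorem siteOp_add (j : ℤ) (x y : Matrix (Fin d) (Fin d) ℂ) :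
    siteOp j (x + y) = siteOp j x + siteOp j y := by
  simp [siteOp, add_smul, Finset.sum_add_distrib]

theorem siteOp_smul (j : ℤ) (c : ℂ) (x : Matrix (Fin d) (Fin d) ℂ) :
    siteOp j (c • x) = c • siteOp j x := by
  simp [siteOp, mul_smul, Finset.smul_sum]

theorem siteOp_conjTranspose (j : ℤ) (x : Matrix (Fin d) (Fin d) ℂ) :
    siteOp j x.conjTranspose = star (siteOp j x) := by
  -- projections and transpositions of basis vectors are self-adjoint, and the transposition of `a`
  -- and `b` intertwines the projections onto the site values `a` and `b`
  have hproj : ∀ a, star (projOp (d := d) j a) = projOp j a := by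
    intro a
    rw [ContinuousLinearMap.star_eq_adjoint]
    symm
    rw [ContinuousLinearMap.eq_adjoint_iff]
    intro ψ φ
    rw [lp.inner_eq_tsum, lp.inner_eq_tsum]
    refine tsum_congr fun σ => ?_
    simp only [projOp_apply]
    split_ifs <;> simp
  have hperm : ∀ a b, star (permOp (swapAt (d := d) j a b) : Hilb d →L[ℂ] Hilb d) =
      permOp (swapAt j a b) := by
    intro a b
    rw [ContinuousLinearMap.star_eq_adjoint, LinearIsometryEquiv.adjoint_eq_symm]
    ext ψ σ
    have : (swapAt (d := d) j a b).symm = swapAt j a b := by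
      refine Equiv.ext fun σ => funext fun k => ?_
      change (if k = j then Equiv.swap a b else Equiv.refl _).symm (σ k) =
        (if k = j then Equiv.swap a b else Equiv.refl _) (σ k)
      split_ifs <;> simp
    change ψ ((swapAt j a b).symm σ) = ψ (swapAt j a b σ)
    rw [this]
  have hcomm : ∀ a b, (permOp (swapAt (d := d) j a b) : Hilb d →L[ℂ] Hilb d) * projOp j a =
      projOp j b * (permOp (swapAt (d := d) j a b) : Hilb d →L[ℂ] Hilb d) := by
    intro a b
    ext ψ σ
    have h1 : swapAt j a b σ j = Equiv.swap a b (σ j) := by simp [swapAt]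
    change (if swapAt j a b σ j = a then ψ (swapAt j a b σ) else 0) =
      if σ j = b then ψ (swapAt j a b σ) else 0
    rw [h1]
    have h2 : (Equiv.swap a b (σ j) = a) ↔ σ j = b := by
      rw [Equiv.swap_apply_eq_iff, Equiv.swap_apply_left]
    simp only [h2]
  rw [siteOp, siteOp, star_sum, Finset.sum_comm]
  refine Finset.sum_congr rfl fun a _ => ?_
  rw [star_sum]
  refine Finset.sum_congr rfl fun b _ => ?_
  rw [star_smul, ← ContinuousLinearMap.mul_def, ← ContinuousLinearMap.mul_def, star_mul, hproj,
    hperm, hcomm, Matrix.conjTranspose_apply]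
  congr 2
  have : swapAt (d := d) j b a = swapAt j a b := by
    simp only [swapAt, Equiv.swap_comm]
  rw [this]

/-- The embedding of the matrices at the site `j`, as a morphism of *-algebras. -/
def siteHom (j : ℤ) : Matrix (Fin d) (Fin d) ℂ →⋆ₐ[ℂ] QuasiLocal d where
  toFun := site j
  map_one' := Subtype.ext (siteOp_one j)
  map_mul' x y := Subtype.ext (siteOp_mul j x y)
  map_zero' := Subtype.ext (by change siteOp j 0 = 0; simp [siteOp])
  map_add' x y := Subtype.ext (siteOp_add j x y)
  commutes' c := Subtype.ext (by
    change siteOp j (algebraMap ℂ _ c) = algebraMap ℂ _ c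
    rw [Algebra.algebraMap_eq_smul_one, Algebra.algebraMap_eq_smul_one, siteOp_smul, siteOp_one])
  map_star' x := Subtype.ext (siteOp_conjTranspose j x)

theorem siteHom_apply (j : ℤ) (x : Matrix (Fin d) (Fin d) ℂ) : siteHom j x = site j x := rfl

theorem star_site (j : ℤ) (x : Matrix (Fin d) (Fin d) ℂ) :
    star (site j x) = site j x.conjTranspose :=
  (map_star (siteHom j) x).symm

theorem site_commute {j k : ℤ} (h : j ≠ k) (x y : Matrix (Fin d) (Fin d) ℂ) :
    site j x * site k y = site k y * site j x :=
  Subtype.ext (siteOp_commute h x y)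

/-- Translations are contractive, so the norm of a single-site operator is bounded uniformly in the
site. -/
theorem norm_site_le (j : ℤ) (x : Matrix (Fin d) (Fin d) ℂ) : ‖site j x‖ ≤ ‖site 0 x‖ := by
  have h := NonUnitalStarAlgHom.norm_apply_le (translate (d := d) j) (site 0 x)
  rwa [translate_site, zero_add] at h

end Site

/-! ### Mean-field operators -/

section MeanField

variable {d : ℕ}

/-- The mean-field operators `x ↦ X^{(N)}`, as a linear map. -/
def meanFieldHom (N : ℕ) : Matrix (Fin d) (Fin d) ℂ →ₗ[ℂ] QuasiLocal d :=
  (N : ℂ)⁻¹ • ∑ k ∈ Finset.range N, (siteHom (k : ℤ)).toAlgHom.toLinearMap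

theorem meanFieldHom_apply (N : ℕ) (x : Matrix (Fin d) (Fin d) ℂ) :
    meanFieldHom N x = meanField N x := by
  simp only [meanFieldHom, meanField, siteSum, LinearMap.smul_apply, LinearMap.sum_apply]
  rfl

theorem norm_meanField_le (N : ℕ) (x : Matrix (Fin d) (Fin d) ℂ) :
    ‖meanField N x‖ ≤ ‖site 0 x‖ := by
  rw [meanField, siteSum, norm_smul, norm_inv, Complex.norm_natCast]
  rcases Nat.eq_zero_or_pos N with rfl | hN
  · simp
  have h : ‖∑ k ∈ Finset.range N, site (k : ℤ) x‖ ≤ N * ‖site 0 x‖ := by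
    refine (norm_sum_le _ _).trans
      ((Finset.sum_le_sum fun (k : ℕ) _ => norm_site_le (k : ℤ) x).trans ?_)
    simp
  have hN' : (0 : ℝ) < N := by exact_mod_cast hN
  rw [inv_mul_le_iff₀ hN']
  exact h

theorem siteSum_commutator (N : ℕ) (x y : Matrix (Fin d) (Fin d) ℂ) :
    siteSum N x * siteSum N y - siteSum N y * siteSum N x = siteSum N ⁅x, y⁆ := by
  simp only [siteSum]
  rw [Finset.sum_mul_sum, Finset.sum_mul_sum,
    Finset.sum_comm (f := fun i j : ℕ => site (i : ℤ) y * site (j : ℤ) x),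
    ← Finset.sum_sub_distrib]
  refine Finset.sum_congr rfl fun k hk => ?_
  rw [← Finset.sum_sub_distrib, Finset.sum_eq_single_of_mem k hk]
  · simp only [← siteHom_apply, Ring.lie_def, map_sub, map_mul]
  · intro l _ hl
    rw [site_commute (by exact_mod_cast hl.symm), sub_self]

theorem star_siteSum (N : ℕ) (x : Matrix (Fin d) (Fin d) ℂ) :
    star (siteSum N x) = siteSum N x.conjTranspose := by
  simp only [siteSum, star_sum, star_site]

theorem star_meanField (N : ℕ) (x : Matrix (Fin d) (Fin d) ℂ) :
    star (meanField N x) = meanField N x.conjTranspose := by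
  rw [meanField, meanField, star_smul, star_siteSum, star_inv₀, star_natCast]

theorem isSelfAdjoint_meanField (N : ℕ) {x : Matrix (Fin d) (Fin d) ℂ} (hx : x.IsHermitian) :
    IsSelfAdjoint (meanField N x) := by
  rw [isSelfAdjoint_iff, star_meanField, hx.eq]

/-- Mean-field operators commute with the whole quasi-local algebra in the limit. -/
theorem tendsto_meanField_commutator (x : Matrix (Fin d) (Fin d) ℂ) (b : QuasiLocal d) :
    Tendsto (fun N : ℕ => meanField N x * b - b * meanField N x) atTop (𝓝 0) := by
  set m : ℕ → Matrix (Fin d) (Fin d) ℂ → Hilb d →L[ℂ] Hilb d := fun N x => (meanField N x).1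
    with hm
  have hloc : ∀ T ∈ localAlg d, ∀ x,
      Tendsto (fun N => m N x * T - T * m N x) atTop (𝓝 0) := by
    intro T hT
    induction hT using StarAlgebra.adjoin_induction with
    | mem T hT =>
      obtain ⟨j, y, rfl⟩ := hT
      intro x
      have hbd : ∀ N, ‖m N x * siteOp j y - siteOp j y * m N x‖ ≤
          (N : ℝ)⁻¹ * ‖siteOp j x * siteOp j y - siteOp j y * siteOp j x‖ := by
        intro N
        have hmN : m N x = (N : ℂ)⁻¹ • ∑ k ∈ Finset.range N, siteOp (k : ℤ) x := by
          have h : ∀ s : Finset ℕ, (∑ k ∈ s, site (k : ℤ) x).1 = ∑ k ∈ s, siteOp (k : ℤ) x := by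
            intro s
            induction s using Finset.induction_on with
            | empty => simp; rfl
            | insert a s ha ih => rw [Finset.sum_insert ha, Finset.sum_insert ha, ← ih]; rfl
          rw [← h]; rfl
        rw [hmN, smul_mul_assoc, mul_smul_comm, ← smul_sub, norm_smul, norm_inv,
          Complex.norm_natCast, Finset.sum_mul, Finset.mul_sum, ← Finset.sum_sub_distrib]
        gcongr
        by_cases hj : ∃ k ∈ Finset.range N, (k : ℤ) = j
        · obtain ⟨k, hk, rfl⟩ := hj
          rw [Finset.sum_eq_single_of_mem k hk]
          intro l _ hl
          rw [siteOp_commute (by exact_mod_cast hl), sub_self]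
        · push Not at hj
          rw [Finset.sum_eq_zero]
          · simp
          · intro l hl
            rw [siteOp_commute (hj l hl), sub_self]
      refine squeeze_zero_norm hbd ?_
      simpa using (tendsto_inv_atTop_nhds_zero_nat (𝕜 := ℝ)).mul_const
        ‖siteOp j x * siteOp j y - siteOp j y * siteOp j x‖
    | algebraMap c =>
      intro x
      simp only [Algebra.commutes, sub_self, tendsto_const_nhds_iff]
    | add S T _ _ hS hT =>
      intro x
      have := (hS x).add (hT x)
      rw [add_zero] at this
      refine this.congr fun N => ?_
      noncomm_ring
    | mul S T _ _ hS hT =>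
      intro x
      have := ((hS x).mul_const T).add ((hT x).const_mul S)
      rw [zero_mul, mul_zero, add_zero] at this
      refine this.congr fun N => ?_
      noncomm_ring
    | star T _ hT =>
      intro x
      have h := (hT x.conjTranspose).star.neg
      rw [star_zero, neg_zero] at h
      refine h.congr fun N => ?_
      have hs : star (m N x.conjTranspose) = m N x := by
        have := congrArg Subtype.val (star_meanField N x.conjTranspose)
        rwa [Matrix.conjTranspose_conjTranspose] at this
      rw [star_sub, star_mul, star_mul, hs, neg_sub]
  -- approximate `b` by a local operator, uniformly in `N` because `‖X^{(N)}‖ ≤ ‖x^{(0)}‖`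
  rw [Metric.tendsto_atTop]
  intro ε hε
  set R : ℝ := ‖site 0 x‖ with hR
  have hR0 : 0 ≤ R := norm_nonneg _
  have hδ : 0 < ε / (4 * (R + 1)) := by positivity
  obtain ⟨T, hT, hbT⟩ := Metric.mem_closure_iff.mp b.2 _ hδ
  obtain ⟨n, hn⟩ := Metric.tendsto_atTop.mp (hloc T hT x) (ε / 2) (by positivity)
  refine ⟨n, fun N hN => ?_⟩
  have h1 := hn N hN
  rw [dist_zero_right] at h1 ⊢
  change ‖m N x * b.1 - b.1 * m N x‖ < ε
  have hmR : ‖m N x‖ ≤ R := norm_meanField_le N x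
  rw [dist_eq_norm] at hbT
  have h2 : m N x * b.1 - b.1 * m N x =
      (m N x * T - T * m N x) + (m N x * (b.1 - T) - (b.1 - T) * m N x) := by noncomm_ring
  have h3 : ‖m N x * (b.1 - T)‖ ≤ R * (ε / (4 * (R + 1))) :=
    (norm_mul_le _ _).trans (mul_le_mul hmR hbT.le (norm_nonneg _) hR0)
  have h4 : ‖(b.1 - T) * m N x‖ ≤ (ε / (4 * (R + 1))) * R :=
    (norm_mul_le _ _).trans (mul_le_mul hbT.le hmR (norm_nonneg _) hδ.le)
  have h5 : R * (ε / (4 * (R + 1))) ≤ ε / 4 := by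
    rw [mul_div_assoc', div_le_div_iff₀ (by positivity) (by norm_num)]
    nlinarith
  rw [h2]
  have h6 := norm_add_le (m N x * T - T * m N x) (m N x * (b.1 - T) - (b.1 - T) * m N x)
  have h7 := norm_sub_le (m N x * (b.1 - T)) ((b.1 - T) * m N x)
  linarith [mul_comm R (ε / (4 * (R + 1)))]

end MeanField

/-! ### The law of large numbers in a clustering state -/

section Clustering

variable {d : ℕ} {ω : QuasiLocal d →ₗ[ℂ] ℂ}

theorem apply_site (hinv : IsTranslationInvariant ω) (n : ℕ) (x : Matrix (Fin d) (Fin d) ℂ) :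
    ω (site (n : ℤ) x) = ω (site 0 x) := by
  induction n with
  | zero => rfl
  | succ n ih =>
    rw [← ih, ← hinv (site (n : ℤ) x), translate_site]
    push_cast
    rfl

theorem apply_meanField (hinv : IsTranslationInvariant ω) {N : ℕ} (hN : N ≠ 0)
    (x : Matrix (Fin d) (Fin d) ℂ) : ω (meanField N x) = ω (site 0 x) := by
  have hN' : (N : ℂ) ≠ 0 := by exact_mod_cast hN
  simp only [meanField, siteSum, map_smul, map_sum, apply_site hinv, Finset.sum_const,
    Finset.card_range, nsmul_eq_mul, smul_eq_mul]
  field_simp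

theorem apply_site_mul_site (hinv : IsTranslationInvariant ω) (k : ℕ) (n : ℤ)
    (x y : Matrix (Fin d) (Fin d) ℂ) :
    ω (site (k : ℤ) x * site (k + n) y) = ω (site 0 x * site n y) := by
  induction k with
  | zero => simp
  | succ k ih =>
    rw [← ih, ← hinv (site (k : ℤ) x * site (k + n) y), map_mul (translate 1), translate_site,
      translate_site]
    push_cast
    rw [add_right_comm]

/-- The averages of a two-sided sequence vanishing at infinity, over the windows `(-N, N)`. -/
theorem tendsto_inv_mul_sum_Ioo {h : ℤ → ℝ} (h0 : ∀ n, 0 ≤ h n) (hp : Tendsto h atTop (𝓝 0))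
    (hm : Tendsto h atBot (𝓝 0)) :
    Tendsto (fun N : ℕ => (N : ℝ)⁻¹ * ∑ n ∈ Finset.Ioo (-(N : ℤ)) N, h n) atTop (𝓝 0) := by
  have h1 := (hp.comp (tendsto_natCast_atTop_atTop (R := ℤ))).cesaro
  have h2 := (hm.comp (tendsto_neg_atTop_atBot.comp (tendsto_natCast_atTop_atTop (R := ℤ)))).cesaro
  have h3 := h1.add h2
  rw [add_zero] at h3
  refine squeeze_zero (fun N => mul_nonneg (by positivity) (Finset.sum_nonneg fun n _ => h0 n))
    (fun N => ?_) h3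
  rw [← mul_add]
  gcongr
  simp only [Function.comp_def]
  have hinj : Function.Injective fun n : ℕ => (n : ℤ) := Nat.cast_injective
  have hinj' : Function.Injective fun n : ℕ => -(n : ℤ) := fun a b hab => by simpa using hab
  rw [← Finset.sum_image (f := h) hinj.injOn, ← Finset.sum_image (f := h) hinj'.injOn,
    ← Finset.sum_union_inter]
  have hsub : Finset.Ioo (-(N : ℤ)) N ⊆ (Finset.range N).image (fun n : ℕ => (n : ℤ)) ∪
      (Finset.range N).image (fun n : ℕ => -(n : ℤ)) := by
    intro n hn
    rw [Finset.mem_Ioo] at hn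
    simp only [Finset.mem_union, Finset.mem_image, Finset.mem_range]
    rcases le_total 0 n with h | h
    · exact Or.inl ⟨n.toNat, by omega, by omega⟩
    · exact Or.inr ⟨(-n).toNat, by omega, by omega⟩
  exact (Finset.sum_le_sum_of_subset_of_nonneg hsub fun n _ _ => h0 n).trans
    (le_add_of_nonneg_right (Finset.sum_nonneg fun n _ => h0 n))

/-- By translation invariance the two-point function of mean-field operators is a double average of
`ω (x^{(0)} y^{(n)})`, which clustering makes converge to the product of the expectations. -/
theorem tendsto_apply_meanField_mul_meanField (hinv : IsTranslationInvariant ω)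
    (hcl : IsClustering ω) (x y : Matrix (Fin d) (Fin d) ℂ) :
    Tendsto (fun N : ℕ => ω (meanField N x * meanField N y)) atTop
      (𝓝 (ω (site 0 x) * ω (site 0 y))) := by
  set g : ℤ → ℂ := fun n => ω (site 0 x * site n y) - ω (site 0 x) * ω (site 0 y) with hg
  have hlim := hcl (star (site 0 x)) (site 0 y) 1
  simp only [star_star, mul_one, translate_site, zero_add] at hlim
  have hp : Tendsto (fun n => ‖g n‖) atTop (𝓝 0) := by
    simpa [hg] using (hlim.1.sub_const (ω (site 0 x) * ω (site 0 y))).norm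
  have hm : Tendsto (fun n => ‖g n‖) atBot (𝓝 0) := by
    simpa [hg] using (hlim.2.sub_const (ω (site 0 x) * ω (site 0 y))).norm
  rw [tendsto_iff_norm_sub_tendsto_zero]
  refine squeeze_zero' (Eventually.of_forall fun _ => norm_nonneg _) ?_
    (tendsto_inv_mul_sum_Ioo (fun _ => norm_nonneg _) hp hm)
  filter_upwards [eventually_ne_atTop 0] with N hN
  have hN' : (N : ℂ) ≠ 0 := by exact_mod_cast hN
  have e1 : ω (meanField N x * meanField N y) - ω (site 0 x) * ω (site 0 y) =
      (N : ℂ)⁻¹ * ((N : ℂ)⁻¹ * ∑ k ∈ Finset.range N, ∑ l ∈ Finset.range N, g (l - k)) := by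
    have e2 : ∀ k l : ℕ, ω (site (k : ℤ) x * site (l : ℤ) y) = ω (site 0 x * site (l - k) y) :=
      fun k l => by rw [← apply_site_mul_site hinv k]; congr 3; ring
    simp only [meanField, siteSum, smul_mul_smul_comm, map_smul, Finset.sum_mul_sum, map_sum, e2,
      hg, Finset.sum_sub_distrib, Finset.sum_const, Finset.card_range, nsmul_eq_mul, smul_eq_mul]
    field_simp
  rw [e1, norm_mul, norm_mul, norm_inv, Complex.norm_natCast]
  have hNr : (0 : ℝ) < N := by exact_mod_cast Nat.pos_of_ne_zero hN
  gcongr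
  rw [inv_mul_le_iff₀ hNr]
  refine (norm_sum_le _ _).trans ?_
  -- each row of the double sum runs over a part of the window `(-N, N)`
  have hrow : ∀ k ∈ Finset.range N, ‖∑ l ∈ Finset.range N, g (l - k)‖ ≤
      ∑ n ∈ Finset.Ioo (-(N : ℤ)) N, ‖g n‖ := by
    intro k hk
    rw [Finset.mem_range] at hk
    refine (norm_sum_le _ _).trans ?_
    have hinj : Function.Injective fun l : ℕ => (l : ℤ) - k := fun a b hab => by simpa using hab
    rw [← Finset.sum_image (f := fun n => ‖g n‖) hinj.injOn]
    refine Finset.sum_le_sum_of_subset_of_nonneg ?_ fun _ _ _ => norm_nonneg _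
    intro n hn
    simp only [Finset.mem_image, Finset.mem_range] at hn
    obtain ⟨l, hl, rfl⟩ := hn
    rw [Finset.mem_Ioo]
    omega
  refine (Finset.sum_le_sum hrow).trans ?_
  simp

end Clustering

/-! ### States as positive functionals -/

section State

attribute [local instance] CStarAlgebra.spectralOrder CStarAlgebra.spectralOrderedRing

variable {d : ℕ} {ω : QuasiLocal d →ₗ[ℂ] ℂ}

/-- A state as a positive linear map. -/
def IsState.toPositive (hω : IsState ω) : QuasiLocal d →ₚ[ℂ] ℂ :=
  .mk₀ ω fun x hx => by
    obtain ⟨s, rfl⟩ := CStarAlgebra.nonneg_iff_eq_star_mul_self.mp hx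
    exact hω.nonneg s

@[simp] theorem IsState.toPositive_apply (hω : IsState ω) (x : QuasiLocal d) :
    hω.toPositive x = ω x := rfl

theorem IsState.norm_apply_le (hω : IsState ω) (x : QuasiLocal d) : ‖ω x‖ ≤ ‖x‖ := by
  have h := MeanFieldChain.norm_apply_le hω.toPositive x
  simpa [hω.normalised] using h

theorem IsState.apply_isSelfAdjoint (hω : IsState ω) {x : QuasiLocal d} (hx : IsSelfAdjoint x) :
    ((ω x).re : ℂ) = ω x := by
  have h := map_star hω.toPositive x
  rw [hx.star_eq] at h
  exact (Complex.conj_eq_iff_re.mp h.symm)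

/-- The mean-field operators converge to scalars on every vector `b Ω` of the GNS representation. -/
theorem tendsto_deviation (hω : IsState ω)
    (hinv : IsTranslationInvariant ω) (hcl : IsClustering ω)
    {x : Matrix (Fin d) (Fin d) ℂ} (hx : x.IsHermitian) (b : QuasiLocal d) {r : ℝ}
    (hr : (r : ℂ) = ω (site 0 x)) :
    Tendsto (fun N : ℕ =>
      ‖(conjFunctional hω.toPositive b).toPreGNS (meanField N x - algebraMap ℂ _ (r : ℂ))‖ ^ 2)
      atTop (𝓝 0) := by
  set φ := hω.toPositive
  set δ : ℕ → QuasiLocal d := fun N => meanField N x - algebraMap ℂ _ (r : ℂ) with hδ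
  have hδs : ∀ N, star (δ N) = δ N := fun N =>
    (isSelfAdjoint_sub_real (isSelfAdjoint_meanField N hx) r).star_eq
  have h0 : Tendsto (fun N => ‖φ.toPreGNS (δ N)‖ ^ 2) atTop (𝓝 0) := by
    have h1 := (tendsto_apply_meanField_mul_meanField hinv hcl x x).sub_const
      (ω (site 0 x) * ω (site 0 x))
    rw [sub_self] at h1
    have h2 := (Complex.continuous_re.tendsto 0).comp h1
    rw [Complex.zero_re] at h2
    refine h2.congr' ?_
    filter_upwards [eventually_ne_atTop 0] with N hN
    rw [← re_apply_star_mul_self, hδs, Function.comp_apply]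
    congr 1
    have e : δ N * δ N = meanField N x * meanField N x - (r : ℂ) • meanField N x -
        (r : ℂ) • meanField N x + ((r : ℂ) * r) • (1 : QuasiLocal d) := by
      simp only [hδ, Algebra.algebraMap_eq_smul_one, mul_sub, sub_mul, smul_mul_assoc, one_mul,
        mul_smul_comm, mul_one]
      module
    rw [e, IsState.toPositive_apply, map_add, map_sub, map_sub, map_smul, map_smul,
      apply_meanField hinv hN, hω.normalised, hr]
    simp only [smul_eq_mul]
    ring
  have h0' : Tendsto (fun N => ‖φ.toPreGNS (δ N)‖) atTop (𝓝 0) := by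
    have := h0.sqrt
    simpa only [Real.sqrt_sq (norm_nonneg _), Real.sqrt_zero] using this
  have hcomm := (tendsto_meanField_commutator x b).norm
  rw [norm_zero] at hcomm
  have hlim := ((h0'.const_mul ‖b‖).add (hcomm.mul_const ‖φ.toPreGNS 1‖)).pow 2
  simp only [mul_zero, zero_mul, add_zero, ne_eq, OfNat.ofNat_ne_zero, not_false_eq_true,
    zero_pow] at hlim
  refine squeeze_zero (fun N => sq_nonneg _) (fun N => ?_) hlim
  have e1 : ‖(conjFunctional φ b).toPreGNS (δ N)‖ ^ 2 = ‖φ.toPreGNS (δ N * b)‖ ^ 2 := by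
    rw [← re_apply_star_mul_self, ← re_apply_star_mul_self, conjFunctional_apply, star_mul]
    simp only [mul_assoc]
  -- move the deviation through `b`, at the price of a commutator that vanishes in norm
  have e2 : δ N * b = b * δ N + (meanField N x * b - b * meanField N x) * 1 := by
    simp only [hδ, sub_mul, mul_sub, Algebra.commutes, mul_one]
    abel
  rw [e1, e2, map_add]
  gcongr
  exact (norm_add_le _ _).trans
    (add_le_add (norm_toPreGNS_mul_le _ _ _) (norm_toPreGNS_mul_le _ _ _))

end State

/-! ### Lindblad generators -/

section Lindblad

variable {A : Type*} [CStarAlgebra A] {ι : Type*} [Fintype ι] {L : A →L[ℂ] A} {K : A} {V : ι → A}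
  {C : Matrix ι ι ℂ}

/-- The hamiltonian part of a Lindblad generator is a derivation; its dissipative part fails to be
one by a sum of products of commutators. -/
theorem lindblad_leibniz
    (hL : ∀ x, L x = Complex.I • (K * x - x * K) + ∑ μ, ∑ ν, (C μ ν / 2) •
      ((V μ * x - x * V μ) * V ν + V μ * (x * V ν - V ν * x))) (x y : A) :
    L (x * y) - L x * y - x * L y =
      ∑ μ, ∑ ν, C μ ν • ((V μ * x - x * V μ) * (y * V ν - V ν * y)) := by
  have h1 : Complex.I • (K * (x * y) - x * y * K) - Complex.I • (K * x - x * K) * y -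
      x * Complex.I • (K * y - y * K) = 0 := by
    simp only [smul_mul_assoc, mul_smul_comm, ← smul_sub]
    rw [show K * (x * y) - x * y * K - (K * x - x * K) * y - x * (K * y - y * K) = 0 by
      noncomm_ring, smul_zero]
  have h2 : L (x * y) - L x * y - x * L y =
      (Complex.I • (K * (x * y) - x * y * K) - Complex.I • (K * x - x * K) * y -
        x * Complex.I • (K * y - y * K)) + ∑ μ, ∑ ν, C μ ν •
          ((V μ * x - x * V μ) * (y * V ν - V ν * y)) := by
    rw [hL, hL, hL, add_mul, mul_add, add_sub_add_comm, add_sub_add_comm]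
    congr 1
    simp only [Finset.sum_mul, Finset.mul_sum, ← Finset.sum_sub_distrib]
    refine Finset.sum_congr rfl fun μ _ => Finset.sum_congr rfl fun ν _ => ?_
    simp only [smul_mul_assoc, mul_smul_comm, ← smul_sub]
    rw [show (V μ * (x * y) - x * y * V μ) * V ν + V μ * (x * y * V ν - V ν * (x * y)) -
        ((V μ * x - x * V μ) * V ν + V μ * (x * V ν - V ν * x)) * y -
        x * ((V μ * y - y * V μ) * V ν + V μ * (y * V ν - V ν * y)) =
        (V μ * x - x * V μ) * (y * V ν - V ν * y) + (V μ * x - x * V μ) * (y * V ν - V ν * y) by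
      noncomm_ring]
    module
  rw [h2, h1, zero_add]

variable [PartialOrder A] [StarOrderedRing A]

open scoped MatrixOrder in
theorem _root_.Matrix.PosSemidef.exists_eq_conjTranspose_mul {ι : Type*} [Fintype ι]
    {C : Matrix ι ι ℂ} (hC : C.PosSemidef) : ∃ B : Matrix ι ι ℂ, C = B.conjTranspose * B := by
  classical
  exact CStarAlgebra.nonneg_iff_eq_star_mul_self.mp hC.nonneg

/-- The Heisenberg semigroup of a Lindblad generator preserves positivity. -/
theorem exp_smul_lindblad_nonneg
    (hL : ∀ x, L x = Complex.I • (K * x - x * K) + ∑ μ, ∑ ν, (C μ ν / 2) •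
      ((V μ * x - x * V μ) * V ν + V μ * (x * V ν - V ν * x)))
    (hK : IsSelfAdjoint K) (hV : ∀ μ, IsSelfAdjoint (V μ)) (hC : C.PosSemidef)
    {t : ℝ} (ht : 0 ≤ t) {x : A} (hx : 0 ≤ x) : 0 ≤ NormedSpace.exp ((t : ℂ) • L) x := by
  set G : A := ∑ μ, ∑ ν, C μ ν • (V μ * V ν) with hG
  have hGs : star G = G := by
    simp only [hG, star_sum, star_smul, star_mul, (hV _).star_eq]
    rw [Finset.sum_comm]
    simp only [hC.isHermitian.apply]
  -- `t L` has the form `Y† x + x Y + Φ x`, where `C = B† B` turns the gain term into the positive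
  -- map `Φ`
  set Y : A := (t : ℂ) • (-(Complex.I • K) - (2⁻¹ : ℂ) • G) with hY
  have hYs : star Y = (t : ℂ) • (Complex.I • K - (2⁻¹ : ℂ) • G) := by
    simp only [hY, star_smul, star_sub, star_neg, hK.star_eq, hGs, Complex.star_def,
      Complex.conj_ofReal, Complex.conj_I, map_inv₀, map_ofNat]
    module
  obtain ⟨B, hB⟩ := hC.exists_eq_conjTranspose_mul
  set W : ι → A := fun k => ∑ ν, B k ν • V ν with hW
  have hWs : ∀ k, star (W k) = ∑ ν, star (B k ν) • V ν := fun k => by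
    simp only [hW, star_sum, star_smul, (hV _).star_eq]
  set Φ : A →L[ℂ] A := ∑ k, (t : ℂ) • ContinuousLinearMap.mulLeftRight ℂ A (star (W k)) (W k)
    with hΦ
  have hΦa : ∀ z, Φ z = ∑ k, (t : ℂ) • (star (W k) * z * W k) := fun z => by
    simp [hΦ, sum_apply]
  have ht' : (0 : ℂ) ≤ (t : ℂ) := by exact_mod_cast ht
  refine exp_lindblad_nonneg (Φ := Φ) (Y := Y) (fun z hz => ?_) (fun z => ?_) hx
  · rw [hΦa]
    exact Finset.sum_nonneg fun k _ => smul_nonneg ht' (star_left_conjugate_nonneg hz _)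
  · have hΦz : ∑ k, star (W k) * z * W k = ∑ μ, ∑ ν, C μ ν • (V μ * z * V ν) := by
      have hk : ∀ k, star (W k) * z * W k =
          ∑ μ, ∑ ν, (star (B k μ) * B k ν) • (V μ * z * V ν) := fun k => by
        rw [hWs, hW]
        simp only [Finset.sum_mul]
        refine Finset.sum_congr rfl fun μ _ => ?_
        rw [Finset.mul_sum]
        refine Finset.sum_congr rfl fun ν _ => ?_
        rw [smul_mul_assoc, smul_mul_smul_comm]
      rw [Finset.sum_congr rfl fun k _ => hk k, Finset.sum_comm]
      refine Finset.sum_congr rfl fun μ _ => ?_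
      rw [Finset.sum_comm]
      refine Finset.sum_congr rfl fun ν _ => ?_
      rw [← Finset.sum_smul, hB, Matrix.mul_apply]
      rfl
    have hLz : L z = Complex.I • (K * z - z * K) + ∑ μ, ∑ ν, C μ ν • (V μ * z * V ν) -
        (2⁻¹ : ℂ) • (G * z) - (2⁻¹ : ℂ) • (z * G) := by
      rw [hL, add_sub_assoc, add_sub_assoc]
      congr 1
      simp only [hG, Finset.sum_mul, Finset.mul_sum, Finset.smul_sum, ← Finset.sum_sub_distrib]
      refine Finset.sum_congr rfl fun μ _ => Finset.sum_congr rfl fun ν _ => ?_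
      simp only [smul_mul_assoc, mul_smul_comm, sub_mul, mul_sub, mul_assoc]
      module
    rw [smul_apply, hLz, hΦa, ← Finset.smul_sum, hΦz, hYs, hY]
    simp only [smul_mul_assoc, mul_smul_comm, sub_mul, mul_sub, mul_neg]
    module

end Lindblad

/-! ### The mean-field generator on mean-field operators -/

namespace Model

variable {d : ℕ} (M : Model d)

/-- The `d²` orthonormal matrices `v_γ` form a basis of `M_d(ℂ)`. -/
theorem sum_trace_smul (x : Matrix (Fin d) (Fin d) ℂ) :
    ∑ γ, (x * M.v γ).trace • M.v γ = x := by
  have htr : ∀ (c : Fin (d ^ 2) → ℂ) γ, ((∑ μ, c μ • M.v μ) * M.v γ).trace = c γ := by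
    intro c γ
    simp [Finset.sum_mul, Matrix.trace_sum, M.v_orth]
  have hli : LinearIndependent ℂ M.v := by
    rw [Fintype.linearIndependent_iff]
    intro c hc γ
    rw [← htr c γ, hc, zero_mul, Matrix.trace_zero]
  have hspan := hli.span_eq_top_of_card_eq_finrank' (by simp [Module.finrank_matrix, sq])
  have hx : x ∈ Submodule.span ℂ (Set.range M.v) := hspan ▸ Submodule.mem_top
  obtain ⟨c, rfl⟩ := (Submodule.mem_span_range_iff_exists_fun ℂ).mp hx
  simp only [htr]

theorem lie_v (α β : Fin (d ^ 2)) : ⁅M.v α, M.v β⁆ = ∑ γ, M.J γ α β • M.v γ :=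
  (M.sum_trace_smul _).symm

theorem J_swap (γ α β : Fin (d ^ 2)) : M.J γ β α = -M.J γ α β := by
  rw [J, J, Ring.lie_def, Ring.lie_def, ← neg_sub, neg_mul, Matrix.trace_neg]

theorem J_cyclic (μ α γ : Fin (d ^ 2)) : M.J μ α γ = M.J γ μ α := by
  simp only [J, Ring.lie_def, sub_mul, Matrix.trace_sub]
  rw [Matrix.trace_mul_cycle (M.v γ), Matrix.trace_mul_cycle (M.v α) (M.v γ),
    Matrix.trace_mul_cycle (M.v α) (M.v μ), Matrix.trace_mul_cycle (M.v γ)]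

theorem conj_J (γ α β : Fin (d ^ 2)) : star (M.J γ α β) = -M.J γ α β := by
  rw [J, ← Matrix.trace_conjTranspose, Matrix.conjTranspose_mul, (M.v_herm γ).eq, Ring.lie_def,
    Matrix.conjTranspose_sub, Matrix.conjTranspose_mul, Matrix.conjTranspose_mul,
    (M.v_herm α).eq, (M.v_herm β).eq, Matrix.trace_mul_comm, ← Matrix.trace_neg, ← neg_mul, neg_sub]

theorem conj_Btilde (μ ν : Fin (d ^ 2)) : star (M.Btilde μ ν) = -M.Btilde μ ν := by
  have h1 : star (M.C μ ν) = M.C ν μ := M.C_pos.isHermitian.apply ν μ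
  have h2 : star (M.C ν μ) = M.C μ ν := M.C_pos.isHermitian.apply μ ν
  simp only [Btilde, Matrix.of_apply, star_add, star_div₀, star_sub, h1, h2, star_mul,
    Complex.star_def, Complex.conj_ofReal, Complex.conj_I, star_ofNat]
  ring

/-- The coefficients of the quadratic part of `𝕃[m_α]` as a polynomial in the `m_β`. -/
def quadCoeff (α β ν : Fin (d ^ 2)) : ℂ :=
  ∑ μ, ((Complex.I * M.h μ ν + M.C μ ν / 2) * M.J β μ α +
    (Complex.I * M.h β μ - M.C β μ / 2) * M.J ν μ α)

/-- The coefficients of the linear part of `𝕃[m_α]` as a polynomial in the `m_β`. -/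
def linCoeff (α β : Fin (d ^ 2)) : ℂ := ∑ μ, Complex.I * M.ε μ * M.J β μ α

/-- `lindblad_apply` with the commutators written out. -/
theorem lindblad_apply_sub (N : ℕ) (x : QuasiLocal d) :
    M.lindblad N x = Complex.I • (M.hamiltonian N * x - x * M.hamiltonian N) +
      ∑ μ, ∑ ν, (M.C μ ν / 2) • ((M.V N μ * x - x * M.V N μ) * M.V N ν +
        M.V N μ * (x * M.V N ν - M.V N ν * x)) :=
  M.lindblad_apply N x

/-- Only equal sites contribute to the commutator, so it is again a mean-field operator. -/
theorem siteSum_mul_meanField_sub (N : ℕ) (x y : Matrix (Fin d) (Fin d) ℂ) :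
    siteSum N x * meanField N y - meanField N y * siteSum N x = meanField N ⁅x, y⁆ := by
  rw [meanField, meanField, mul_smul_comm, smul_mul_assoc, ← smul_sub, siteSum_commutator]

theorem V_mul_meanField_sub (N : ℕ) (μ : Fin (d ^ 2)) (y : Matrix (Fin d) (Fin d) ℂ) :
    M.V N μ * meanField N y - meanField N y * M.V N μ =
      ((Real.sqrt N : ℝ) : ℂ)⁻¹ • meanField N ⁅M.v μ, y⁆ := by
  rw [V, mul_smul_comm, smul_mul_assoc, ← smul_sub, siteSum_mul_meanField_sub]

theorem inv_sqrt_mul_inv_sqrt (N : ℕ) :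
    ((Real.sqrt N : ℝ) : ℂ)⁻¹ * ((Real.sqrt N : ℝ) : ℂ)⁻¹ = (N : ℂ)⁻¹ := by
  rw [← mul_inv, ← Complex.ofReal_mul, Real.mul_self_sqrt (Nat.cast_nonneg N),
    Complex.ofReal_natCast]

theorem meanField_lie_v (N : ℕ) (μ α : Fin (d ^ 2)) :
    meanField N ⁅M.v μ, M.v α⁆ = ∑ γ, M.J γ μ α • meanField N (M.v γ) := by
  simp only [lie_v, ← meanFieldHom_apply, map_sum, map_smul]

/-- The generator maps a mean-field operator to a quadratic polynomial in the mean-field operators,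
with coefficients that do not depend on `N`: each commutator with an extensive sum
`∑_k v_μ^{(k)}` gives again a mean-field operator. -/
theorem lindblad_meanField (N : ℕ) (α : Fin (d ^ 2)) :
    M.lindblad N (meanField N (M.v α)) =
      ∑ β, ∑ ν, M.quadCoeff α β ν • (meanField N (M.v β) * meanField N (M.v ν)) +
        ∑ β, M.linCoeff α β • meanField N (M.v β) := by
  set m : Fin (d ^ 2) → QuasiLocal d := fun β => meanField N (M.v β) with hm
  set a : Fin (d ^ 2) → QuasiLocal d := fun μ => meanField N ⁅M.v μ, M.v α⁆ with ha
  have hK : M.hamiltonian N * m α - m α * M.hamiltonian N =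
      ∑ μ, (M.ε μ : ℂ) • a μ + ∑ μ, ∑ ν, M.h μ ν • (m μ * a ν + a μ * m ν) := by
    have h1 : ∀ μ, siteSum N (M.v μ) * m α - m α * siteSum N (M.v μ) = a μ := fun μ =>
      siteSum_mul_meanField_sub N _ _
    rw [hamiltonian, add_mul, mul_add, add_sub_add_comm]
    simp only [Finset.sum_mul, Finset.mul_sum, ← Finset.sum_sub_distrib, smul_mul_assoc,
      mul_smul_comm, ← smul_sub, h1]
    congr 1
    refine Finset.sum_congr rfl fun μ _ => Finset.sum_congr rfl fun ν _ => ?_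
    congr 1
    rw [show siteSum N (M.v μ) * siteSum N (M.v ν) * m α -
        m α * (siteSum N (M.v μ) * siteSum N (M.v ν)) =
        siteSum N (M.v μ) * (siteSum N (M.v ν) * m α - m α * siteSum N (M.v ν)) +
        (siteSum N (M.v μ) * m α - m α * siteSum N (M.v μ)) * siteSum N (M.v ν) by noncomm_ring,
      h1, h1, smul_add, ← smul_mul_assoc, ← mul_smul_comm]
    rfl
  have hD : ∀ μ ν, (M.V N μ * m α - m α * M.V N μ) * M.V N ν +
        M.V N μ * (m α * M.V N ν - M.V N ν * m α) = a μ * m ν - m μ * a ν := by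
    intro μ ν
    rw [← neg_sub (M.V N ν * m α), hm, V_mul_meanField_sub, V_mul_meanField_sub, V, V, mul_neg,
      smul_mul_smul_comm, smul_mul_smul_comm, inv_sqrt_mul_inv_sqrt, ← smul_mul_assoc,
      ← mul_smul_comm, ← sub_eq_add_neg]
    simp only [meanField, ha, smul_mul_assoc, mul_smul_comm]
  have haJ : ∀ μ, a μ = ∑ γ, M.J γ μ α • m γ := fun μ => M.meanField_lie_v N μ α
  have hD' : ∑ μ, ∑ ν, (M.C μ ν / 2) • ((M.V N μ * m α - m α * M.V N μ) * M.V N ν +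
        M.V N μ * (m α * M.V N ν - M.V N ν * m α)) =
      ∑ μ, ∑ ν, (M.C μ ν / 2) • (a μ * m ν - m μ * a ν) :=
    Finset.sum_congr rfl fun μ _ => Finset.sum_congr rfl fun ν _ => by rw [hD]
  rw [lindblad_apply_sub, hK, hD']
  have h1 : Complex.I • (∑ μ, (M.ε μ : ℂ) • a μ + ∑ μ, ∑ ν, M.h μ ν • (m μ * a ν + a μ * m ν)) +
      ∑ μ, ∑ ν, (M.C μ ν / 2) • (a μ * m ν - m μ * a ν) =
      (∑ μ, ∑ ν, (Complex.I * M.h μ ν + M.C μ ν / 2) • (a μ * m ν) +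
        ∑ μ, ∑ ν, (Complex.I * M.h μ ν - M.C μ ν / 2) • (m μ * a ν)) +
        ∑ μ, (Complex.I * M.ε μ) • a μ := by
    simp only [smul_add, smul_sub, add_smul, sub_smul, mul_smul, Finset.smul_sum,
      Finset.sum_add_distrib, Finset.sum_sub_distrib]
    abel
  rw [h1]
  congr 1
  · simp only [quadCoeff, Finset.sum_smul, add_smul, Finset.sum_add_distrib, haJ, Finset.sum_mul,
      Finset.mul_sum, Finset.smul_sum, smul_mul_assoc, mul_smul_comm, smul_smul]
    congr 1
    · exact Finset.sum_comm.trans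
        ((Finset.sum_congr rfl fun ν _ => Finset.sum_comm).trans Finset.sum_comm)
    · exact Finset.sum_congr rfl fun μ _ => Finset.sum_comm
  · simp only [linCoeff, haJ, Finset.smul_sum, Finset.sum_smul, smul_smul]
    rw [Finset.sum_comm]

/-- A bound on `N` times the failure of the Leibniz rule for `𝕃^{(N)}` on the squares of the
mean-field operators. -/
def leibnizDefect : ℝ :=
  ∑ α, ∑ μ, ∑ ν, ‖M.C μ ν‖ * (‖(site 0 ⁅M.v μ, M.v α⁆ : QuasiLocal d)‖ *
    ‖(site 0 ⁅M.v ν, M.v α⁆ : QuasiLocal d)‖)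

/-- On the mean-field operators `𝕃^{(N)}` is a derivation up to a dissipative term of
order `1/N`. -/
theorem norm_leibniz_meanField_le (N : ℕ) (α : Fin (d ^ 2)) :
    ‖M.lindblad N (meanField N (M.v α) * meanField N (M.v α)) -
      M.lindblad N (meanField N (M.v α)) * meanField N (M.v α) -
      meanField N (M.v α) * M.lindblad N (meanField N (M.v α))‖ ≤
      (N : ℝ)⁻¹ * M.leibnizDefect := by
  have hterm : ∀ μ ν, ‖M.C μ ν • ((M.V N μ * meanField N (M.v α) -
      meanField N (M.v α) * M.V N μ) *
      (meanField N (M.v α) * M.V N ν - M.V N ν * meanField N (M.v α)))‖ ≤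
      (N : ℝ)⁻¹ * (‖M.C μ ν‖ * (‖(site 0 ⁅M.v μ, M.v α⁆ : QuasiLocal d)‖ *
        ‖(site 0 ⁅M.v ν, M.v α⁆ : QuasiLocal d)‖)) := by
    intro μ ν
    rw [← neg_sub (M.V N ν * _), V_mul_meanField_sub, V_mul_meanField_sub, mul_neg,
      smul_mul_smul_comm, inv_sqrt_mul_inv_sqrt, norm_smul, norm_neg, norm_smul, norm_inv,
      Complex.norm_natCast, mul_left_comm]
    gcongr
    exact (norm_mul_le _ _).trans (mul_le_mul (norm_meanField_le _ _) (norm_meanField_le _ _)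
      (norm_nonneg _) (norm_nonneg _))
  rw [lindblad_leibniz (M.lindblad_apply_sub N)]
  have h1 : ‖∑ μ, ∑ ν, M.C μ ν • ((M.V N μ * meanField N (M.v α) -
      meanField N (M.v α) * M.V N μ) *
      (meanField N (M.v α) * M.V N ν - M.V N ν * meanField N (M.v α)))‖ ≤
      ∑ μ, ∑ ν, (N : ℝ)⁻¹ * (‖M.C μ ν‖ * (‖(site 0 ⁅M.v μ, M.v α⁆ : QuasiLocal d)‖ *
        ‖(site 0 ⁅M.v ν, M.v α⁆ : QuasiLocal d)‖)) :=
    norm_sum_le_of_le _ fun μ _ => norm_sum_le_of_le _ fun ν _ => hterm μ ν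
  refine h1.trans ?_
  simp only [← Finset.mul_sum]
  gcongr
  rw [leibnizDefect]
  exact Finset.single_le_sum (f := fun α => ∑ μ, ∑ ν, ‖M.C μ ν‖ *
    (‖(site 0 ⁅M.v μ, M.v α⁆ : QuasiLocal d)‖ * ‖(site 0 ⁅M.v ν, M.v α⁆ : QuasiLocal d)‖))
    (fun α _ => by positivity) (Finset.mem_univ α)

theorem leibnizDefect_nonneg : 0 ≤ M.leibnizDefect := by
  rw [leibnizDefect]; positivity

theorem isSelfAdjoint_V (N : ℕ) (μ : Fin (d ^ 2)) : IsSelfAdjoint (M.V N μ) := by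
  rw [isSelfAdjoint_iff, V, star_smul, star_siteSum, (M.v_herm μ).eq, star_inv₀,
    Complex.star_def, Complex.conj_ofReal]

theorem isSelfAdjoint_hamiltonian (N : ℕ) : IsSelfAdjoint (M.hamiltonian N) := by
  have hs : ∀ μ, star (siteSum N (M.v μ)) = siteSum N (M.v μ) := fun μ => by
    rw [star_siteSum, (M.v_herm μ).eq]
  rw [isSelfAdjoint_iff, hamiltonian, star_add, star_sum, star_sum]
  congr 1
  · refine Finset.sum_congr rfl fun μ _ => ?_
    rw [star_smul, hs, Complex.star_def, Complex.conj_ofReal]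
  · simp only [star_sum, star_smul, star_mul, hs, star_inv₀, star_natCast]
    rw [Finset.sum_comm]
    refine Finset.sum_congr rfl fun μ _ => Finset.sum_congr rfl fun ν _ => ?_
    rw [M.h_herm.apply]

theorem lindblad_one (N : ℕ) : M.lindblad N 1 = 0 := by
  rw [lindblad_apply_sub]
  simp

section Positivity

attribute [local instance] CStarAlgebra.spectralOrder CStarAlgebra.spectralOrderedRing

theorem γ_nonneg (N : ℕ) {t : ℝ} (ht : 0 ≤ t) {x : QuasiLocal d} (hx : 0 ≤ x) :
    0 ≤ M.γ N t x :=
  exp_smul_lindblad_nonneg (M.lindblad_apply_sub N) (M.isSelfAdjoint_hamiltonian N)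
    (M.isSelfAdjoint_V N) M.C_pos ht hx

end Positivity

end Model

/-! ### Global existence of the rotated single-site dynamics -/

section Flow

open scoped NNReal

/-- A bounded Lipschitz vector field is complete: by boundedness the Picard–Lindelöf theorem applies
on every interval `[-T, T]`, and the solutions agree where they are both defined. -/
theorem exists_integralCurve_of_lipschitz_of_bounded {E : Type*} [NormedAddCommGroup E]
    [NormedSpace ℝ E] [CompleteSpace E] {F : E → E} {K B : ℝ≥0} (hF : LipschitzWith K F)
    (hB : ∀ x, ‖F x‖ ≤ B) (x₀ : E) :
    ∃ u : ℝ → E, u 0 = x₀ ∧ ∀ t, HasDerivAt u (F (u t)) t := by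
  have hloc : ∀ T : ℝ, 0 < T → ∃ u : ℝ → E, u 0 = x₀ ∧
      ∀ t ∈ Set.Ioo (-T) T, HasDerivAt u (F (u t)) t := by
    intro T hT
    let t₀ : Set.Icc (-T) T := ⟨0, by constructor <;> linarith⟩
    have hPL : IsPicardLindelof (fun _ => F) t₀ x₀ (B * T.toNNReal) 0 B K := by
      refine IsPicardLindelof.of_time_independent (fun x _ => hB x) hF.lipschitzOnWith ?_
      simp [t₀, hT.le]
    obtain ⟨u, hu0, hu⟩ := hPL.exists_eq_forall_mem_Icc_hasDerivWithinAt₀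
    exact ⟨u, hu0, fun t ht => (hu t (Set.Ioo_subset_Icc_self ht)).hasDerivAt
      (Icc_mem_nhds ht.1 ht.2)⟩
  choose! u hu0 hu using hloc
  have huniq : ∀ S T : ℝ, 0 < S → S ≤ T → Set.EqOn (u S) (u T) (Set.Ioo (-S) S) := by
    intro S T hS hST
    refine ODE_solution_unique_of_mem_Ioo (v := fun _ => F) (s := fun _ => Set.univ) (K := K)
      (t₀ := 0) (fun _ _ => hF.lipschitzOnWith) (by constructor <;> linarith)
      (fun t ht => ⟨hu S hS t ht, trivial⟩)
      (fun t ht => ⟨hu T (hS.trans_le hST) t ⟨by linarith [ht.1], by linarith [ht.2]⟩, trivial⟩) ?_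
    rw [hu0 S hS, hu0 T (hS.trans_le hST)]
  refine ⟨fun t => u (|t| + 1) t, hu0 _ (by positivity), fun t => ?_⟩
  have hT : 0 < |t| + 2 := by positivity
  have h1 := hu (|t| + 2) hT t
    ⟨by linarith [neg_abs_le t], by linarith [le_abs_self t]⟩
  have hev : (fun s => u (|s| + 1) s) =ᶠ[𝓝 t] u (|t| + 2) := by
    have : ∀ᶠ s in 𝓝 t, |s| < |t| + 1 :=
      (continuous_abs.tendsto t).eventually_lt_const (by linarith)
    filter_upwards [this] with s hs
    exact huniq (|s| + 1) (|t| + 2) (by positivity) (by linarith)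
      ⟨by linarith [neg_abs_le s], by linarith [le_abs_self s]⟩
  have h2 : u (|t| + 1) t = u (|t| + 2) t :=
    huniq (|t| + 1) (|t| + 2) (by positivity) (by linarith)
      ⟨by linarith [neg_abs_le t], by linarith [le_abs_self t]⟩
  simp only [h2]
  exact h1.congr_of_eventuallyEq hev

namespace Model

variable {d : ℕ} (M : Model d)

/-- The expectations `ω((U† v_α U)^{(0)})`, which are real in a state; see `coe_rotated`. -/
def rotated (ω : QuasiLocal d →ₗ[ℂ] ℂ) (U : Matrix (Fin d) (Fin d) ℂ) (α : Fin (d ^ 2)) : ℝ :=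
  (ω (site 0 (U.conjTranspose * M.v α * U))).re

theorem isHermitian_siteHam (r : Fin (d ^ 2) → ℝ) : (M.siteHam r).IsHermitian := by
  rw [Matrix.IsHermitian, siteHam, Finset.smul_sum, Matrix.conjTranspose_sum]
  refine Finset.sum_congr rfl fun μ _ => ?_
  have h : ∀ ν, star (M.Btilde μ ν) = -M.Btilde μ ν := M.conj_Btilde μ
  rw [smul_smul, Matrix.conjTranspose_smul, (M.v_herm μ).eq]
  congr 1
  simp only [star_mul, star_add, star_sum, h, star_neg, Complex.star_def, Complex.conj_ofReal,
    Complex.conj_I]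
  simp only [mul_neg, Finset.sum_neg_distrib, mul_comm]
  ring

open scoped Matrix.Norms.L2Operator in
/-- The nonlinear equation `U' = -i H(r(U)) U`, where `r(U)` are the expectations of the rotated
`v_α`, has a global unitary solution, along which observables satisfy Heisenberg's equation.
The cubic vector field is made bounded and Lipschitz by a real cut-off equal to `1` near the
unitaries; as `H` is hermitian and the cut-off real, `U† U` is conserved, so that the cut-off is
never felt. -/
theorem exists_flow (ω : QuasiLocal d →ₗ[ℂ] ℂ) :
    ∃ U : ℝ → Matrix (Fin d) (Fin d) ℂ, U 0 = 1 ∧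
      (∀ t, U t ∈ Matrix.unitaryGroup (Fin d) ℂ) ∧
      (∀ t i j, HasDerivAt (fun s => U s i j)
        (((-Complex.I) • (M.siteHam (M.rotated ω (U t)) * U t)) i j) t) ∧
      ∀ t x, HasDerivAt (fun s => ω (site 0 ((U s).conjTranspose * x * U s)))
        (ω (site 0 ((U t).conjTranspose * (Complex.I • (M.siteHam (M.rotated ω (U t)) * x -
          x * M.siteHam (M.rotated ω (U t)))) * U t))) t := by
  let θ : ContDiffBump (0 : Matrix (Fin d) (Fin d) ℂ) :=
    ⟨‖(1 : Matrix (Fin d) (Fin d) ℂ)‖ + 1, ‖(1 : Matrix (Fin d) (Fin d) ℂ)‖ + 2,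
      by positivity, by linarith⟩
  let H : Matrix (Fin d) (Fin d) ℂ → Matrix (Fin d) (Fin d) ℂ := fun W =>
    M.siteHam (M.rotated ω W)
  let ℓ : Matrix (Fin d) (Fin d) ℂ →L[ℝ] ℂ := LinearMap.toContinuousLinearMap
    ((ω ∘ₗ (siteHom (d := d) 0).toAlgHom.toLinearMap).restrictScalars ℝ)
  have hℓ : ∀ x, ℓ x = ω (site 0 x) := fun _ => rfl
  have hr : ∀ α, ContDiff ℝ 1 fun W => (M.rotated ω W α : ℂ) := by
    intro α
    have h1 : ContDiff ℝ 1 fun W : Matrix (Fin d) (Fin d) ℂ => star W * M.v α * W :=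
      (((starL' ℝ).contDiff).mul contDiff_const).mul contDiff_id
    exact Complex.ofRealCLM.contDiff.comp (Complex.reCLM.contDiff.comp (ℓ.contDiff.comp h1))
  have hH : ContDiff ℝ 1 H := by
    have hb : ∀ μ, ContDiff ℝ 1 fun W =>
        ∑ ν, M.Btilde μ ν * (M.rotated ω W ν : ℂ) + Complex.I * (M.ε μ : ℂ) := fun μ =>
      (ContDiff.sum fun ν _ => contDiff_const.mul (hr ν)).add contDiff_const
    change ContDiff ℝ 1 fun W => (-Complex.I) •
      ∑ μ, (∑ ν, M.Btilde μ ν * (M.rotated ω W ν : ℂ) + Complex.I * (M.ε μ : ℂ)) • M.v μ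
    exact ContDiff.const_smul _ (ContDiff.sum fun μ _ => (hb μ).smul contDiff_const)
  let F : Matrix (Fin d) (Fin d) ℂ → Matrix (Fin d) (Fin d) ℂ := fun W =>
    θ W • ((-Complex.I) • (H W * W))
  have hF : ContDiff ℝ 1 F := θ.contDiff.smul ((hH.mul contDiff_id).const_smul (-Complex.I))
  have hFc : HasCompactSupport F := θ.hasCompactSupport.smul_right
  obtain ⟨K, hK⟩ := hF.lipschitzWith_of_hasCompactSupport hFc one_ne_zero
  obtain ⟨B, hB⟩ := hFc.exists_bound_of_continuous hF.continuous
  obtain ⟨U, hU0, hU⟩ := exists_integralCurve_of_lipschitz_of_bounded hK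
    (fun x => (hB x).trans (Real.le_coe_toNNReal B)) 1
  have hHs : ∀ W, star (H W) = H W := fun W => M.isHermitian_siteHam _
  have hstar : ∀ t, HasDerivAt (fun s => star (U s)) (star (F (U t))) t := fun t =>
    ((starL' (A := Matrix (Fin d) (Fin d) ℂ) ℝ).toContinuousLinearMap.hasFDerivAt).comp_hasDerivAt
      t (hU t)
  have hUU : ∀ t, star (U t) * U t = 1 := by
    intro t
    have hd : ∀ t, HasDerivAt (fun s => star (U s) * U s) 0 t := by
      intro t
      refine ((hstar t).mul (hU t)).congr_deriv ?_
      simp only [F, star_smul, star_mul, hHs, star_neg, Complex.star_def, Complex.conj_I, neg_neg,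
        star_trivial, smul_mul_assoc, mul_smul_comm, mul_assoc, neg_smul, smul_neg, mul_neg,
        add_neg_cancel]
    have := is_const_of_deriv_eq_zero (fun t => (hd t).differentiableAt) (fun t => (hd t).deriv) t 0
    simpa [hU0] using this
  have hmem : ∀ t, U t ∈ Matrix.unitaryGroup (Fin d) ℂ := fun t =>
    Matrix.mem_unitaryGroup_iff'.mpr (hUU t)
  have hθ : ∀ t, θ (U t) = 1 := by
    intro t
    refine θ.one_of_mem_closedBall ?_
    rw [mem_closedBall_zero_iff]
    have h1 := CStarRing.norm_mem_unitary_mul (U := U t) (1 : Matrix (Fin d) (Fin d) ℂ) (hmem t)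
    rw [mul_one] at h1
    rw [h1]
    exact le_add_of_nonneg_right zero_le_one
  have hU' : ∀ t, HasDerivAt U ((-Complex.I) • (H (U t) * U t)) t := fun t => by
    have := hU t
    simpa only [F, hθ, one_smul] using this
  refine ⟨U, hU0, hmem, fun t i j => ?_, fun t x => ?_⟩
  · let e : Matrix (Fin d) (Fin d) ℂ →L[ℝ] ℂ := LinearMap.toContinuousLinearMap
      ((Matrix.entryLinearMap ℂ ℂ i j).restrictScalars ℝ)
    exact e.hasFDerivAt.comp_hasDerivAt t (hU' t)
  · have h1 := (((hstar t).mul_const x).mul (hU t))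
    refine (ℓ.hasFDerivAt.comp_hasDerivAt t h1).congr_deriv ?_
    rw [hℓ]
    congr 2
    simp only [F, hθ, one_smul, star_smul, star_mul, hHs, star_neg, Complex.star_def,
      Complex.conj_I, neg_neg, ← Matrix.star_eq_conjTranspose]
    change _ = star (U t) * (Complex.I • (H (U t) * x - x * H (U t))) * U t
    simp only [smul_add, smul_neg, mul_add, add_mul, mul_neg, neg_mul, smul_mul_assoc,
      mul_smul_comm, mul_assoc, neg_smul, sub_eq_add_neg]

end Model

end Flow

/-! ### The macroscopic equations of motion -/

namespace Model

variable {d : ℕ} (M : Model d) {ω : QuasiLocal d →ₗ[ℂ] ℂ}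

theorem coe_rotated (hω : IsState ω) (U : Matrix (Fin d) (Fin d) ℂ) (α : Fin (d ^ 2)) :
    (M.rotated ω U α : ℂ) = ω (site 0 (U.conjTranspose * M.v α * U)) :=
  hω.apply_isSelfAdjoint <| by
    rw [isSelfAdjoint_iff, star_site,
      (Matrix.isHermitian_conjTranspose_mul_mul U (M.v_herm α)).eq]

/-- The rotated expectations of the basis determine those of all matrices. -/
theorem apply_site_conj_eq_sum (hω : IsState ω) (U x : Matrix (Fin d) (Fin d) ℂ) :
    ω (site 0 (U.conjTranspose * x * U)) =
      ∑ γ, (x * M.v γ).trace * (M.rotated ω U γ : ℂ) := by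
  conv_lhs => rw [← M.sum_trace_smul x]
  simp only [coe_rotated M hω, Finset.mul_sum, Finset.sum_mul, mul_smul_comm, smul_mul_assoc,
    ← siteHom_apply, map_sum, map_smul, smul_eq_mul]

theorem abs_rotated_le (hω : IsState ω) {U : Matrix (Fin d) (Fin d) ℂ}
    (hU : U ∈ Matrix.unitaryGroup (Fin d) ℂ) (α : Fin (d ^ 2)) :
    |M.rotated ω U α| ≤ ‖(site 0 (M.v α) : QuasiLocal d)‖ := by
  have hu : siteHom (d := d) 0 U ∈ unitary (QuasiLocal d) := by
    rw [Unitary.mem_iff, ← map_star, ← map_mul, ← map_mul]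
    exact ⟨by rw [(Unitary.mem_iff.mp hU).1, map_one], by rw [(Unitary.mem_iff.mp hU).2, map_one]⟩
  have h1 : site 0 (U.conjTranspose * M.v α * U) =
      star (siteHom (d := d) 0 U) * site 0 (M.v α) * siteHom 0 U := by
    rw [← map_star, ← siteHom_apply, ← siteHom_apply, ← map_mul, ← map_mul]
    rfl
  refine (Complex.abs_re_le_norm _).trans ((hω.norm_apply_le _).trans (le_of_eq ?_))
  rw [h1, CStarRing.norm_mul_mem_unitary _ hu, CStarRing.norm_mem_unitary_mul _
    (Unitary.star_mem hu)]

/-- The right-hand side of the macroscopic equations of motion. -/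
def velocity (r : Fin (d ^ 2) → ℝ) (α : Fin (d ^ 2)) : ℂ :=
  ∑ μ, (∑ ν, M.Btilde μ ν * (r ν : ℂ) + Complex.I * (M.ε μ : ℂ)) * ∑ γ, M.J γ μ α * (r γ : ℂ)

theorem smul_siteHam_commutator (r : Fin (d ^ 2) → ℝ) (x : Matrix (Fin d) (Fin d) ℂ) :
    Complex.I • (M.siteHam r * x - x * M.siteHam r) =
      ∑ μ, (∑ ν, M.Btilde μ ν * (r ν : ℂ) + Complex.I * (M.ε μ : ℂ)) • ⁅M.v μ, x⁆ := by
  simp only [siteHam, smul_mul_assoc, mul_smul_comm, ← smul_sub, smul_smul, Finset.sum_mul,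
    Finset.mul_sum, ← Finset.sum_sub_distrib, Ring.lie_def]
  simp

theorem apply_rotated_commutator (hω : IsState ω) (U : Matrix (Fin d) (Fin d) ℂ)
    (α : Fin (d ^ 2)) :
    ω (site 0 (U.conjTranspose * (Complex.I • (M.siteHam (M.rotated ω U) * M.v α -
      M.v α * M.siteHam (M.rotated ω U))) * U)) = M.velocity (M.rotated ω U) α := by
  rw [smul_siteHam_commutator, velocity]
  simp only [Finset.mul_sum, Finset.sum_mul, mul_smul_comm, smul_mul_assoc, ← siteHom_apply,
    map_sum, map_smul]
  refine Finset.sum_congr rfl fun μ _ => ?_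
  rw [siteHom_apply, M.apply_site_conj_eq_sum hω, smul_eq_mul]
  simp only [J, Finset.mul_sum]

/-- The coefficients of `𝕃[m_α]`, symmetrised by the commutativity of the scalars `r`, are those of
the macroscopic equations: `h_{μν} + h_{νμ} = 2 Re h_{μν}` by hermiticity. -/
theorem velocity_eq_poly (r : Fin (d ^ 2) → ℝ) (α : Fin (d ^ 2)) :
    M.velocity r α = ∑ β, ∑ ν, M.quadCoeff α β ν * (r β * r ν) + ∑ β, M.linCoeff α β * r β := by
  have hh : ∀ μ ν, M.h μ ν + M.h ν μ = 2 * ((M.h μ ν).re : ℂ) := by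
    intro μ ν
    rw [← M.h_herm.apply ν μ, Complex.star_def, Complex.add_conj]
    push_cast
    rfl
  have hB : ∀ μ ν, M.Btilde μ ν = (Complex.I * M.h μ ν + M.C μ ν / 2) +
      (Complex.I * M.h ν μ - M.C ν μ / 2) := by
    intro μ ν
    rw [Btilde, Matrix.of_apply]
    linear_combination (-Complex.I) * hh μ ν
  have hXY : ∀ X Y : Fin (d ^ 2) → Fin (d ^ 2) → ℂ,
      ∑ β, ∑ ν, (∑ μ, (X μ ν * M.J β μ α + Y β μ * M.J ν μ α)) * ((r β : ℂ) * r ν) =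
      ∑ μ, ∑ γ, ∑ ν, (X μ ν + Y ν μ) * r ν * (M.J γ μ α * r γ) := by
    intro X Y
    simp only [Finset.sum_mul, add_mul, Finset.sum_add_distrib]
    congr 1
    · refine ((Finset.sum_congr rfl fun β _ => Finset.sum_comm).trans Finset.sum_comm).trans ?_
      refine Finset.sum_congr rfl fun _ _ => Finset.sum_congr rfl fun _ _ =>
        Finset.sum_congr rfl fun _ _ => ?_
      ring
    · refine (Finset.sum_comm.trans
        ((Finset.sum_congr rfl fun ν _ => Finset.sum_comm).trans Finset.sum_comm)).trans ?_
      refine Finset.sum_congr rfl fun _ _ => Finset.sum_congr rfl fun _ _ =>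
        Finset.sum_congr rfl fun _ _ => ?_
      ring
  have h1 : ∑ β, ∑ ν, M.quadCoeff α β ν * ((r β : ℂ) * r ν) =
      ∑ μ, ∑ γ, ∑ ν, M.Btilde μ ν * r ν * (M.J γ μ α * r γ) := by
    simp only [hB]
    exact hXY (fun μ ν => Complex.I * M.h μ ν + M.C μ ν / 2)
      (fun β μ => Complex.I * M.h β μ - M.C β μ / 2)
  have h2 : ∑ β, M.linCoeff α β * (r β : ℂ) =
      ∑ μ, ∑ γ, Complex.I * M.ε μ * (M.J γ μ α * r γ) := by
    simp only [linCoeff, Finset.sum_mul]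
    rw [Finset.sum_comm]
    simp only [mul_assoc]
  rw [h1, h2, velocity]
  simp only [add_mul, Finset.sum_add_distrib, Finset.sum_mul, Finset.mul_sum]

theorem velocity_eq_sum (r : Fin (d ^ 2) → ℝ) (α : Fin (d ^ 2)) :
    M.velocity r α = ∑ μ, ∑ γ, (∑ ν, M.Btilde μ ν * (r ν : ℂ) + Complex.I * (M.ε μ : ℂ)) *
      M.J μ α γ * (r γ : ℂ) := by
  simp only [velocity, Finset.mul_sum, M.J_cyclic _ α, mul_assoc]

theorem velocity_eq_mulVec (r : Fin (d ^ 2) → ℝ) (α : Fin (d ^ 2)) :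
    M.velocity r α = (M.D r).mulVec (fun β => (r β : ℂ)) α := by
  rw [velocity_eq_sum, Finset.sum_comm, Matrix.mulVec, dotProduct]
  refine Finset.sum_congr rfl fun γ _ => ?_
  rw [← Finset.sum_mul, D, Matrix.of_apply, Finset.mul_sum, ← Finset.sum_add_distrib]
  congr 1
  refine Finset.sum_congr rfl fun μ _ => ?_
  rw [add_mul, Finset.sum_mul]
  congr 1
  · exact Finset.sum_congr rfl fun ν _ => by ring
  · ring

theorem D_im (r : Fin (d ^ 2) → ℝ) (α β : Fin (d ^ 2)) : (M.D r α β).im = 0 := by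
  rw [← Complex.conj_eq_iff_im, ← Complex.star_def, D, Matrix.of_apply]
  have hJ : ∀ μ, star (M.J μ α β) = -M.J μ α β := fun μ => M.conj_J μ α β
  have hB : ∀ μ ν, star (M.Btilde μ ν) = -M.Btilde μ ν := M.conj_Btilde
  simp only [star_add, star_sum, star_mul, hJ, hB]
  simp only [Complex.star_def, Complex.conj_ofReal, Complex.conj_I, neg_mul, mul_neg,
    Finset.sum_neg_distrib, neg_neg]
  congr 1
  · exact Finset.sum_congr rfl fun μ _ => Finset.sum_congr rfl fun ν _ => by ring
  · simp only [mul_comm]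

theorem D_swap (r : Fin (d ^ 2) → ℝ) (α β : Fin (d ^ 2)) : M.D r β α = -M.D r α β := by
  simp only [D, Matrix.of_apply, M.J_swap _ α β, neg_mul, mul_neg, Finset.sum_neg_distrib]
  ring

end Model

/-! ### The limit of the mean-field dynamics -/

section Limit

attribute [local instance] CStarAlgebra.spectralOrder CStarAlgebra.spectralOrderedRing

variable {d : ℕ} (M : Model d) {ω : QuasiLocal d →ₗ[ℂ] ℂ}

theorem Model.γ_one (N : ℕ) (t : ℝ) : M.γ N t 1 = 1 :=
  exp_apply_eq_self (by simp [M.lindblad_one])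

/-- The expectation of `γ_t^{(N)}[·]` in the vector `b Ω`. -/
def evolved (hω : IsState ω) (b : QuasiLocal d) (N : ℕ) {t : ℝ} (ht : 0 ≤ t) :
    QuasiLocal d →ₚ[ℂ] ℂ :=
  compPositive (conjFunctional hω.toPositive b) (M.γ N t) fun _ => M.γ_nonneg N ht

theorem evolved_apply (hω : IsState ω) (b : QuasiLocal d) (N : ℕ) {t : ℝ} (ht : 0 ≤ t)
    (x : QuasiLocal d) : evolved M hω b N ht x = ω (star b * M.γ N t x * b) := rfl

/-- The mean square deviation of the evolved mean-field operators from the macroscopic trajectory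
vanishes in the limit, on every vector `b Ω` and at every time. -/
theorem tendsto_evolved_deviation (hω : IsState ω) (hinv : IsTranslationInvariant ω)
    (hcl : IsClustering ω) {U : ℝ → Matrix (Fin d) (Fin d) ℂ} (hU0 : U 0 = 1)
    (hU : ∀ t, U t ∈ Matrix.unitaryGroup (Fin d) ℂ)
    (hder : ∀ t α, HasDerivAt (fun s => (M.rotated ω (U s) α : ℂ))
      (M.velocity (M.rotated ω (U t)) α) t)
    (b : QuasiLocal d) {t : ℝ} (ht : 0 ≤ t) :
    Tendsto (fun N : ℕ => (evolved M hω b N ht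
      (deviation (fun α => meanField N (M.v α)) (M.rotated ω (U t)))).re) atTop (𝓝 0) := by
  set φ := conjFunctional hω.toPositive b with hφ
  set R : ℝ := ∑ α, ‖(site 0 (M.v α) : QuasiLocal d)‖ with hR
  have hR0 : 0 ≤ R := Finset.sum_nonneg fun _ _ => norm_nonneg _
  have hvR : ∀ α, ‖(site 0 (M.v α) : QuasiLocal d)‖ ≤ R := fun α =>
    Finset.single_le_sum (f := fun α => ‖(site 0 (M.v α) : QuasiLocal d)‖)
      (fun _ _ => norm_nonneg _) (Finset.mem_univ α)
  have hreal : ∀ t α, HasDerivAt (fun s => M.rotated ω (U s) α)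
      (M.velocity (M.rotated ω (U t)) α).re t := by
    intro t α
    have h := (Complex.reCLM.hasFDerivAt (x := (M.rotated ω (U t) α : ℂ))).comp_hasDerivAt
      (f := fun s => (M.rotated ω (U s) α : ℂ)) t (hder t α)
    exact h
  have hvel : ∀ t α, (((M.velocity (M.rotated ω (U t)) α).re : ℝ) : ℂ) =
      M.velocity (M.rotated ω (U t)) α := fun t α =>
    (hreal t α).ofReal_comp.unique (hder t α)
  have hsa : ∀ N α, IsSelfAdjoint (meanField N (M.v α)) := fun N α =>
    isSelfAdjoint_meanField N (M.v_herm α)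
  have hbound : ∀ N : ℕ, (evolved M hω b N ht
      (deviation (fun α => meanField N (M.v α)) (M.rotated ω (U t)))).re ≤
      Real.exp (deviationRate M.quadCoeff M.linCoeff R * t) *
        ((φ (deviation (fun α => meanField N (M.v α)) (M.rotated ω (U 0)))).re +
          Fintype.card (Fin (d ^ 2)) * ((N : ℝ)⁻¹ * M.leibnizDefect) * (φ 1).re * t) := fun N =>
    deviation_le M.quadCoeff M.linCoeff φ (fun s hs x hx => M.γ_nonneg N hs hx)
      (M.lindblad_one N) (hsa N) (M.lindblad_meanField N)
      (mul_nonneg (by positivity) M.leibnizDefect_nonneg) hR0 (M.norm_leibniz_meanField_le N)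
      (fun α => (norm_meanField_le N _).trans (hvR α))
      (r := fun t => M.rotated ω (U t)) (fun t α => (M.abs_rotated_le hω (hU t) α).trans (hvR α))
      hreal (fun t α => (hvel t α).trans (M.velocity_eq_poly _ α)) ht
  have hinit : Tendsto (fun N : ℕ =>
      (φ (deviation (fun α => meanField N (M.v α)) (M.rotated ω (U 0)))).re) atTop (𝓝 0) := by
    simp only [re_apply_deviation φ (hsa _)]
    have h0 := tendsto_finsetSum Finset.univ fun α _ =>
      tendsto_deviation (r := M.rotated ω (U 0) α) hω hinv hcl (M.v_herm α) b (by
        rw [M.coe_rotated hω, hU0]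
        simp)
    rwa [Finset.sum_const_zero] at h0
  refine squeeze_zero (fun N => ?_) hbound ?_
  · rw [re_apply_deviation _ (hsa N)]
    exact Finset.sum_nonneg fun _ _ => sq_nonneg _
  · have h1 := (((tendsto_inv_atTop_nhds_zero_nat (𝕜 := ℝ)).mul_const M.leibnizDefect).const_mul
      (Fintype.card (Fin (d ^ 2)) : ℝ)).mul_const (φ 1).re |>.mul_const t
    have h2 := (hinit.add h1).const_mul (Real.exp (deviationRate M.quadCoeff M.linCoeff R * t))
    simpa using h2

theorem tendsto_evolved_meanField (hω : IsState ω) (hinv : IsTranslationInvariant ω)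
    (hcl : IsClustering ω) {U : ℝ → Matrix (Fin d) (Fin d) ℂ} (hU0 : U 0 = 1)
    (hU : ∀ t, U t ∈ Matrix.unitaryGroup (Fin d) ℂ)
    (hder : ∀ t α, HasDerivAt (fun s => (M.rotated ω (U s) α : ℂ))
      (M.velocity (M.rotated ω (U t)) α) t)
    (b : QuasiLocal d) {t : ℝ} (ht : 0 ≤ t) (α : Fin (d ^ 2)) :
    Tendsto (fun N : ℕ => ω (star b * (M.γ N t (meanField N (M.v α)) -
      algebraMap ℂ _ (M.rotated ω (U t) α : ℂ)) * b)) atTop (𝓝 0) := by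
  set r := M.rotated ω (U t) with hr
  have hdev := tendsto_evolved_deviation M hω hinv hcl hU0 hU hder b ht
  have hlim := (hdev.sqrt.const_mul ‖(1 : QuasiLocal d)‖).const_mul
    (Real.sqrt (ω (star b * 1 * b)).re)
  rw [Real.sqrt_zero, mul_zero, mul_zero] at hlim
  refine squeeze_zero_norm (fun N => ?_) hlim
  set ψ := evolved M hω b N ht with hψ
  set δ : QuasiLocal d := meanField N (M.v α) - algebraMap ℂ _ (r α : ℂ) with hδ
  have h1 := norm_apply_star_mul_mul_le ψ 1 1 δ
  rw [star_one, one_mul, one_mul] at h1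
  have h2 : ψ δ = ω (star b * (M.γ N t (meanField N (M.v α)) -
      algebraMap ℂ _ (r α : ℂ)) * b) := by
    rw [hψ, evolved_apply, hδ, map_sub, Algebra.algebraMap_eq_smul_one, map_smul, M.γ_one]
  have h3 : ‖ψ.toPreGNS 1‖ = Real.sqrt (ω (star b * 1 * b)).re := by
    rw [← Real.sqrt_sq (norm_nonneg _), ← re_apply_star_mul_self, star_one, one_mul, hψ,
      evolved_apply, M.γ_one]
  have h4 : ‖ψ.toPreGNS δ‖ ≤
      Real.sqrt (ψ (deviation (fun α => meanField N (M.v α)) r)).re := by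
    refine Real.le_sqrt_of_sq_le ?_
    rw [re_apply_deviation ψ fun α => isSelfAdjoint_meanField N (M.v_herm α)]
    exact Finset.single_le_sum (f := fun α => ‖ψ.toPreGNS (meanField N (M.v α) -
      algebraMap ℂ _ (r α : ℂ))‖ ^ 2) (fun _ _ => sq_nonneg _) (Finset.mem_univ α)
  rw [← h2]
  refine h1.trans ?_
  rw [h3]
  gcongr

/-- The polarisation identity for the sesquilinear map `(a, b) ↦ a† x b`. -/
theorem polarization (x a b : QuasiLocal d) :
    star a * x * b = (4⁻¹ : ℂ) • (star (b + a) * x * (b + a) - star (b - a) * x * (b - a) +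
      Complex.I • (star (b + Complex.I • a) * x * (b + Complex.I • a)) -
      Complex.I • (star (b - Complex.I • a) * x * (b - Complex.I • a))) := by
  simp only [star_add, star_sub, star_smul, Complex.star_def, Complex.conj_I, add_mul, sub_mul,
    mul_add, mul_sub, smul_mul_assoc, mul_smul_comm, smul_add, smul_sub, smul_smul, neg_smul,
    neg_mul, smul_neg]
  match_scalars <;> ring_nf <;> norm_num [Complex.I_sq]

/-- Convergence of the evolved mean-field operators, between arbitrary quasi-local operators. -/
theorem tendsto_apply_γ_meanField (hω : IsState ω) (hinv : IsTranslationInvariant ω)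
    (hcl : IsClustering ω) {U : ℝ → Matrix (Fin d) (Fin d) ℂ} (hU0 : U 0 = 1)
    (hU : ∀ t, U t ∈ Matrix.unitaryGroup (Fin d) ℂ)
    (hder : ∀ t α, HasDerivAt (fun s => (M.rotated ω (U s) α : ℂ))
      (M.velocity (M.rotated ω (U t)) α) t)
    {t : ℝ} (ht : 0 ≤ t) (x : Matrix (Fin d) (Fin d) ℂ) (a b : QuasiLocal d) :
    Tendsto (fun N : ℕ => ω (a * M.γ N t (meanField N x) * b)) atTop
      (𝓝 (ω (a * b) * ω (site 0 ((U t).conjTranspose * x * U t)))) := by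
  have hq := tendsto_evolved_meanField M hω hinv hcl hU0 hU hder
  have hv : ∀ α, Tendsto (fun N : ℕ => ω (a * M.γ N t (meanField N (M.v α)) * b)) atTop
      (𝓝 (ω (a * b) * M.rotated ω (U t) α)) := by
    intro α
    have h := ((((hq (b + star a) ht α).sub (hq (b - star a) ht α)).add
      ((hq (b + Complex.I • star a) ht α).const_mul Complex.I)).sub
      ((hq (b - Complex.I • star a) ht α).const_mul Complex.I)).const_mul (4⁻¹ : ℂ)
    simp only [sub_zero, mul_zero, add_zero] at h
    have h' := h.add_const (ω (a * b) * M.rotated ω (U t) α)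
    rw [zero_add] at h'
    refine h'.congr fun N => ?_
    have hp := congrArg ω (polarization (M.γ N t (meanField N (M.v α)) -
      algebraMap ℂ _ (M.rotated ω (U t) α : ℂ)) (star a) b)
    simp only [map_smul, map_add ω, map_sub ω, smul_eq_mul, star_star] at hp
    rw [← hp, Algebra.algebraMap_eq_smul_one, mul_sub, sub_mul, map_sub, mul_smul_comm, mul_one,
      smul_mul_assoc, map_smul, smul_eq_mul]
    ring
  have hsum := tendsto_finsetSum Finset.univ fun γ _ => (hv γ).const_mul (x * M.v γ).trace
  rw [M.apply_site_conj_eq_sum hω, Finset.mul_sum]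
  simp only [mul_left_comm (ω (a * b))]
  refine hsum.congr fun N => ?_
  conv_rhs => rw [← M.sum_trace_smul x]
  simp only [← meanFieldHom_apply, map_sum, map_smul, Finset.mul_sum, Finset.sum_mul,
    mul_smul_comm, smul_mul_assoc, smul_eq_mul]

end Limit

end MeanFieldChain
end

theorem mainTheorem6 (d : ℕ) (M : MeanFieldChain.Model d)
    (ω : MeanFieldChain.QuasiLocal d →ₗ[ℂ] ℂ) (hω : MeanFieldChain.IsState ω)
    (hinv : MeanFieldChain.IsTranslationInvariant ω) (hcl : MeanFieldChain.IsClustering ω) :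
    -- the macroscopic averages `w t α = ω_α(t)` and `wc t α β = ω_{αβ}(t)`
    ∃ (w : ℝ → Fin (d ^ 2) → ℝ) (wc : ℝ → Fin (d ^ 2) → Fin (d ^ 2) → ℂ),
      (∀ t : ℝ, 0 ≤ t → ∀ α,
        Tendsto (fun N : ℕ => M.macroAvg ω N t (M.v α)) atTop (𝓝 (w t α : ℂ))) ∧
      (∀ t : ℝ, 0 ≤ t → ∀ α β,
        Tendsto (fun N : ℕ => M.macroAvg ω N t ⁅M.v α, M.v β⁆) atTop (𝓝 (wc t α β))) ∧
      (∀ t : ℝ, 0 ≤ t → ∀ α β, wc t α β = ∑ γ, M.J γ α β * (w t γ : ℂ)) ∧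
      (∀ α, (w 0 α : ℂ) = ω (MeanFieldChain.site 0 (M.v α))) ∧
      -- the equations of motion, in their three equivalent forms
      (∀ t : ℝ, 0 ≤ t → ∀ α,
        HasDerivWithinAt (fun s : ℝ => (w s α : ℂ))
          (∑ μ, (∑ ν, M.Btilde μ ν * (w t ν : ℂ) + Complex.I * (M.ε μ : ℂ)) * wc t μ α)
          (Set.Ici 0) t) ∧
      (∀ t : ℝ, 0 ≤ t → ∀ α,
        HasDerivWithinAt (fun s : ℝ => (w s α : ℂ))
          (∑ μ, ∑ γ, (∑ ν, M.Btilde μ ν * (w t ν : ℂ) + Complex.I * (M.ε μ : ℂ)) *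
            M.J μ α γ * (w t γ : ℂ))
          (Set.Ici 0) t) ∧
      (∀ t : ℝ, 0 ≤ t → ∀ α,
        HasDerivWithinAt (fun s : ℝ => (w s α : ℂ))
          ((M.D (w t)).mulVec (fun β => (w t β : ℂ)) α) (Set.Ici 0) t) ∧
      -- `D` is real and antisymmetric
      (∀ (r : Fin (d ^ 2) → ℝ) (α β : Fin (d ^ 2)),
        (M.D r α β).im = 0 ∧ M.D r β α = -M.D r α β) ∧
      -- convergence to the automorphic dynamics on mean-field operators
      ∃ U : ℝ → Matrix (Fin d) (Fin d) ℂ,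
        U 0 = 1 ∧
        (∀ t : ℝ, 0 ≤ t → U t ∈ Matrix.unitaryGroup (Fin d) ℂ) ∧
        (∀ t : ℝ, 0 ≤ t → ∀ i j,
          HasDerivWithinAt (fun s : ℝ => U s i j)
            (((-Complex.I) • (M.siteHam (w t) * U t)) i j) (Set.Ici 0) t) ∧
        (∀ t : ℝ, 0 ≤ t → ∀ α,
          ω (MeanFieldChain.site 0 ((U t).conjTranspose * M.v α * U t)) = (w t α : ℂ)) ∧
        (∀ t : ℝ, 0 ≤ t → ∀ (x : Matrix (Fin d) (Fin d) ℂ) (a b : MeanFieldChain.QuasiLocal d),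
          Tendsto (fun N : ℕ => ω (a * M.γ N t (MeanFieldChain.meanField N x) * b)) atTop
            (𝓝 (ω (a * b) *
              ω (MeanFieldChain.site 0 ((U t).conjTranspose * x * U t)))) ∧
          Tendsto (fun N : ℕ => ω (a * MeanFieldChain.meanField N
              ((U t).conjTranspose * x * U t) * b)) atTop
            (𝓝 (ω (a * b) *
              ω (MeanFieldChain.site 0 ((U t).conjTranspose * x * U t))))) := by
  obtain ⟨U, hU0, hU, hUder, hrot⟩ := M.exists_flow ω
  have hw : ∀ t α, HasDerivAt (fun s => (M.rotated ω (U s) α : ℂ))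
      (M.velocity (M.rotated ω (U t)) α) t := by
    intro t α
    simp only [M.coe_rotated hω]
    exact (hrot t (M.v α)).congr_deriv (M.apply_rotated_commutator hω (U t) α)
  have hlim : ∀ t : ℝ, 0 ≤ t → ∀ x (a b : MeanFieldChain.QuasiLocal d), _ := fun t ht x a b =>
    MeanFieldChain.tendsto_apply_γ_meanField M hω hinv hcl hU0 hU hw ht x a b
  have hexp : ∀ t : ℝ, 0 ≤ t → ∀ x, Tendsto (fun N : ℕ => M.macroAvg ω N t x) atTop
      (𝓝 (ω (MeanFieldChain.site 0 ((U t).conjTranspose * x * U t)))) := by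
    intro t ht x
    have h := hlim t ht x 1 1
    simp only [one_mul, mul_one, hω.normalised] at h
    exact h
  refine ⟨fun t => M.rotated ω (U t), fun t α β => ∑ γ, M.J γ α β * (M.rotated ω (U t) γ : ℂ),
    fun t ht α => ?_, fun t ht α β => ?_, fun _ _ _ _ => rfl, fun α => ?_, fun t _ α => ?_,
    fun t _ α => ?_, fun t _ α => ?_, fun r α β => ⟨M.D_im r α β, M.D_swap r α β⟩, U, hU0,
    fun t _ => hU t, fun t _ i j => (hUder t i j).hasDerivWithinAt,
    fun t _ α => (M.coe_rotated hω (U t) α).symm, fun t ht x a b => ⟨hlim t ht x a b, ?_⟩⟩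
  · rw [M.coe_rotated hω]
    exact hexp t ht (M.v α)
  · have h := hexp t ht ⁅M.v α, M.v β⁆
    rwa [M.apply_site_conj_eq_sum hω] at h
  · rw [M.coe_rotated hω, hU0]
    simp
  · exact (hw t α).hasDerivWithinAt
  · exact ((hw t α).congr_deriv (M.velocity_eq_sum _ α)).hasDerivWithinAt
  · exact ((hw t α).congr_deriv (M.velocity_eq_mulVec _ α)).hasDerivWithinAt
  · -- at time zero the semigroup is the identity and the rotation is trivial
    have h := hlim 0 le_rfl ((U t).conjTranspose * x * U t) a b
    have h0 : ∀ N y, M.γ N 0 y = y := fun N y => MeanFieldChain.exp_apply_eq_self (by simp)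
    simpa only [h0, hU0, Matrix.conjTranspose_one, one_mul, mul_one] using h
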